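/- **Setting.** There are $n$ agents with effort costs $c_1,\dots,c_n>0$ and a monotone submodular reward function $f:2^{[n]}\to[0,1]$ with $f(\emptyset)=0$. A *team contract* $(S,\alpha)$ consists of a team $S\subseteq[n]$ and shares $\alpha_i\in[0,1]$ for $i\in S$ (and $\alpha_i=0$ for $i\notin S$) such that every $i\in S$ is incentivized: $\alpha_i f(S)-c_i\ge \alpha_i f(S\setminus\{i\})$. Its revenue is $\mathrm{Rev}(S,\alpha)=\bigl(1-\sum_{i\in S}\alpha_i\bigr)f(S)$. A set $E\subseteq S$ is an equilibrium of $(S,\alpha)$, for arbitrary shares $\alpha$, if $\alpha_i f(E)-c_i\ge\alpha_i f(E\setminus\{i\})$ for $i\in E$ and $\alpha_i f(E\cup\{i\})-c_i<\alpha_i f(E)$ for $i\in S\setminus E$. The contract $(S,\alpha)$ is *non-discriminatory* if $\alpha_i=\alpha_j$ for all $i,j\in S$. It is *fair* if for all $i,j\in S$, with $\hat\alpha$ obtained from $\alpha$ by exchanging $\alpha_i$ and $\alpha_j$, there is an equilibrium $E$ of $(S,\hat\alpha)$ such that $$\alpha_i f(S)-c_i\ge\alpha_j f(E)-c_i\mathbf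 1[i\in E],\qquad \alpha_j f(S)-c_j\ge\alpha_i f(E)-c_j\mathbf 1[j\in E].$$ An algorithm is given $n$ and $c$ and accesses $f$ only through a value oracle ($S\mapsto f(S)$) and a demand oracle, which for prices $p\in\mathbb R_{\ge0}^n$ returns some maximizer of $f(T)-\sum_{i\in T}p_i$ over $T\subseteq[n]$. **Theorem.** There are a constant $\kappa>0$ and a single algorithm which, for every $n$, every such $c$ and $f$, and every demand oracle for $f$, outputs a team contract $(S,\alpha)$ such that 1. $(S,\alpha)$ is non-discriminatory, and $\mathrm{Rev}(S,\alpha)\ge\kappa\,\mathrm{Rev}(T,\beta)$ for every non-discriminatory contract $(T,\beta)$; 2. $(S,\alpha)$ is fair, and $\mathrm{Rev}(S,\alpha)\ge\kappa\,\mathrm{Rev}(T,\beta)$ for every fair contract $(T,\beta)$; so it is a constant-factor approximation to the optimal fair contract. The algorithm runs in polynomial time: the number of elementary steps (arithmetic operations and comparisons of numbers, index and set operations, oracle queries, a query being charged at least $n$ steps) is bounded by a polynomial in $n$ alone; and if all $c_i$ and all values $f(S)$ are rational numbers whose reduced numerator and denominator have at most $b$ bits in total, then its running time with every operation on numbers charged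 by the bit lengths of the numbers involved is bounded by a polynomial in $n+b$. -/

import Mathlib

noncomputable section

namespace TeamContract

/-! ### The model -/

/-- A reward function is submodular if marginal contributions decrease with the set. -/
def IsSubmodular {n : ℕ} (f : Finset (Fin n) → ℝ) : Prop :=
  ∀ S' S : Finset (Fin n), S' ⊆ S → ∀ i : Fin n, f (insert i S) - f S ≤ f (insert i S') - f S'

/-- A team-contract problem with `n` agents: effort costs and a submodular reward function
(the success probability of the project as a function of the set of agents exerting effort). -/
structure Problem (n : ℕ) where
  /-- effort costs -/
  c : Fin n → ℝ
  /-- reward function -/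
  f : Finset (Fin n) → ℝ
  c_pos : ∀ i, 0 < c i
  f_nonneg : ∀ S, 0 ≤ f S
  f_le_one : ∀ S, f S ≤ 1
  f_mono : ∀ S' S, S' ⊆ S → f S' ≤ f S
  f_empty : f ∅ = 0
  f_submodular : IsSubmodular f

variable {n : ℕ}

/-- `E` is a pure Nash equilibrium of the team `S` under the linear contracts `α`
(indifferent agents exert effort). -/
def Problem.IsEquilibrium (I : Problem n) (S : Finset (Fin n)) (α : Fin n → ℝ)
    (E : Finset (Fin n)) : Prop :=
  E ⊆ S ∧
  (∀ i ∈ E, α i * I.f E - I.c i ≥ α i * I.f (E.erase i)) ∧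
  (∀ i ∈ S \ E, α i * I.f (insert i E) - I.c i < α i * I.f E)

/-- `(S, α)` is a (feasible) team contract: shares lie in `[0, 1]`, agents outside the team get
nothing, and every member of the team is incentivized to exert effort when the team does. -/
structure Problem.IsContract (I : Problem n) (S : Finset (Fin n)) (α : Fin n → ℝ) : Prop where
  mem_Icc : ∀ i ∈ S, 0 ≤ α i ∧ α i ≤ 1
  eq_zero : ∀ i, i ∉ S → α i = 0
  feasible : ∀ i ∈ S, α i * I.f S - I.c i ≥ α i * I.f (S.erase i)

/-- The principal's expected revenue. -/
def Problem.rev (I : Problem n) (S : Finset (Fin n)) (α : Fin n → ℝ) : ℝ :=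
  (1 - ∑ i ∈ S, α i) * I.f S

open Classical in
/-- Fair team contracts: no pair of team members envies under the swap of their contracts. -/
def Problem.IsFair (I : Problem n) (S : Finset (Fin n)) (α : Fin n → ℝ) : Prop :=
  I.IsContract S α ∧
  ∀ i ∈ S, ∀ j ∈ S, ∃ E : Finset (Fin n),
    I.IsEquilibrium S (α ∘ Equiv.swap i j) E ∧
    α i * I.f S - I.c i ≥ α j * I.f E - I.c i * (if i ∈ E then 1 else 0) ∧
    α j * I.f S - I.c j ≥ α i * I.f E - I.c j * (if j ∈ E then 1 else 0)

/-- Non-discriminatory team contracts: all team members get the same share. -/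
def Problem.IsNonDiscriminatory (I : Problem n) (S : Finset (Fin n)) (α : Fin n → ℝ) : Prop :=
  I.IsContract S α ∧ ∀ i ∈ S, ∀ j ∈ S, α i = α j

/-- `D` answers demand queries for `f`: at nonnegative prices `p` the set `D p` maximizes
`f T - ∑ i ∈ T, p i`.  Nothing is promised at other prices. -/
def IsDemandOracle (f : Finset (Fin n) → ℝ) (D : (Fin n → ℝ) → Finset (Fin n)) : Prop :=
  ∀ p : Fin n → ℝ, (∀ i, 0 ≤ p i) →
    ∀ T : Finset (Fin n), f T - ∑ i ∈ T, p i ≤ f (D p) - ∑ i ∈ D p, p i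

/-! ### Algorithms with a value oracle and a demand oracle

An algorithm is a program of a small imperative language with index registers (natural numbers,
which can only be copied, incremented and compared), arrays of numbers, and registers for sets of
agents.  Programs are finite objects containing only natural and rational literals, and one
program serves all numbers of agents.  The reward function is accessible through the two oracle
commands only. -/

/-- Index expressions; `agents` is the number of agents. -/
inductive IdxExpr where
  | lit (k : ℕ)
  | reg (i : ℕ)
  | agents
  | succ (e : IdxExpr)

/-- Number expressions; `entry a e` is the entry of array `a` at index `e`, and `ofIdx e` is an
index read as a number. -/
inductive NumExpr where
  | lit (r : ℚ)
  | entry (a : ℕ) (e : IdxExpr)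
  | ofIdx (e : IdxExpr)
  | add (x y : NumExpr)
  | sub (x y : NumExpr)
  | mul (x y : NumExpr)
  | div (x y : NumExpr)

/-- Tests; `isMember e R` asks whether agent number `e` belongs to set register `R`. -/
inductive Test where
  | idxLt (e e' : IdxExpr)
  | numLe (x y : NumExpr)
  | isMember (e : IdxExpr) (R : ℕ)
  | neg (b : Test)

/-- Programs. -/
inductive Prog where
  | skip
  | seq (P Q : Prog)
  | cond (b : Test) (P Q : Prog)
  | loop (b : Test) (P : Prog)
  /-- index register `i := e` -/
  | setIdx (i : ℕ) (e : IdxExpr)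
  /-- entry `e` of array `a := x` -/
  | setNum (a : ℕ) (e : IdxExpr) (x : NumExpr)
  /-- set register `R := ∅` -/
  | clear (R : ℕ)
  /-- set register `R := R ∪ {e}` -/
  | include_ (R : ℕ) (e : IdxExpr)
  /-- set register `R := R \ {e}` -/
  | exclude (R : ℕ) (e : IdxExpr)
  /-- set register `R := R'` -/
  | copy (R R' : ℕ)
  /-- value query: entry `e` of array `a := f(R)` -/
  | value (a : ℕ) (e : IdxExpr) (R : ℕ)
  /-- demand query: set register `R :=` the demanded set at the prices in array `a` -/
  | demand (R : ℕ) (a : ℕ)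

/-- Memory contents when there are `n` agents. -/
structure Store (n : ℕ) where
  /-- index registers -/
  idx : ℕ → ℕ
  /-- number arrays -/
  num : ℕ → ℕ → ℝ
  /-- set registers -/
  team : ℕ → Finset (Fin n)

/-- The agent with number `k` as a set; empty if there is no such agent. -/
def agentSet (n k : ℕ) : Finset (Fin n) := Finset.univ.filter (fun j => (j : ℕ) = k)

/-- Value of an index expression. -/
def IdxExpr.eval (s : Store n) : IdxExpr → ℕ
  | .lit k => k
  | .reg i => s.idx i
  | .agents => n
  | .succ e => e.eval s + 1

/-- Value of a number expression (exact arithmetic; a quotient by `0` is `0`). -/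
def NumExpr.eval (s : Store n) : NumExpr → ℝ
  | .lit r => (r : ℝ)
  | .entry a e => s.num a (e.eval s)
  | .ofIdx e => (e.eval s : ℝ)
  | .add x y => x.eval s + y.eval s
  | .sub x y => x.eval s - y.eval s
  | .mul x y => x.eval s * y.eval s
  | .div x y => x.eval s / y.eval s

/-- Truth of a test. -/
def Test.holds (s : Store n) : Test → Prop
  | .idxLt e e' => e.eval s < e'.eval s
  | .numLe x y => x.eval s ≤ y.eval s
  | .isMember e R => ∃ j ∈ s.team R, (j : ℕ) = e.eval s
  | .neg b => ¬ b.holds s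

/-- Time to evaluate a number expression, when handling a number `x` takes time `sz x`. -/
def NumExpr.cost (sz : ℝ → ℕ) (s : Store n) : NumExpr → ℕ
  | .lit r => sz (r : ℝ)
  | .entry a e => sz (s.num a (e.eval s))
  | .ofIdx e => sz (e.eval s : ℝ)
  | .add x y => x.cost sz s + y.cost sz s + sz (x.eval s + y.eval s)
  | .sub x y => x.cost sz s + y.cost sz s + sz (x.eval s - y.eval s)
  | .mul x y => x.cost sz s + y.cost sz s + sz (x.eval s * y.eval s)
  | .div x y => x.cost sz s + y.cost sz s + sz (x.eval s / y.eval s)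

/-- Time to evaluate a test. -/
def Test.cost (sz : ℝ → ℕ) (s : Store n) : Test → ℕ
  | .idxLt _ _ => 1
  | .numLe x y => 1 + x.cost sz s + y.cost sz s
  | .isMember _ _ => 1
  | .neg b => 1 + b.cost sz s

/-- `s` with index register `i` overwritten. -/
def Store.putIdx (s : Store n) (i k : ℕ) : Store n :=
  { s with idx := Function.update s.idx i k }

/-- `s` with entry `k` of array `a` overwritten. -/
def Store.putNum (s : Store n) (a k : ℕ) (x : ℝ) : Store n :=
  { s with num := Function.update s.num a (Function.update (s.num a) k x) }

/-- `s` with set register `R` overwritten. -/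
def Store.putTeam (s : Store n) (R : ℕ) (S : Finset (Fin n)) : Store n :=
  { s with team := Function.update s.team R S }

/-- `Exec f D sz P s s' t`: with value oracle `f` and demand oracle `D`, program `P` started in `s`
halts in `s'` after time `t`, where handling a number `x` takes time `sz x`.  Commands that handle
a whole set of agents, in particular oracle queries, are also charged for its `n` bits. -/
inductive Exec (f : Finset (Fin n) → ℝ) (D : (Fin n → ℝ) → Finset (Fin n)) (sz : ℝ → ℕ) :
    Prog → Store n → Store n → ℕ → Prop
  | skip (s : Store n) : Exec f D sz .skip s s 1
  | seq {P Q : Prog} {s s' s'' : Store n} {t t' : ℕ} :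
      Exec f D sz P s s' t → Exec f D sz Q s' s'' t' → Exec f D sz (.seq P Q) s s'' (t + t')
  | cond_true {b : Test} {P Q : Prog} {s s' : Store n} {t : ℕ} :
      b.holds s → Exec f D sz P s s' t → Exec f D sz (.cond b P Q) s s' (b.cost sz s + t)
  | cond_false {b : Test} {P Q : Prog} {s s' : Store n} {t : ℕ} :
      ¬ b.holds s → Exec f D sz Q s s' t → Exec f D sz (.cond b P Q) s s' (b.cost sz s + t)
  | loop_true {b : Test} {P : Prog} {s s' s'' : Store n} {t t' : ℕ} :
      b.holds s → Exec f D sz P s s' t → Exec f D sz (.loop b P) s' s'' t' →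
      Exec f D sz (.loop b P) s s'' (b.cost sz s + t + t')
  | loop_false {b : Test} {P : Prog} {s : Store n} :
      ¬ b.holds s → Exec f D sz (.loop b P) s s (b.cost sz s)
  | setIdx (i : ℕ) (e : IdxExpr) (s : Store n) :
      Exec f D sz (.setIdx i e) s (s.putIdx i (e.eval s)) 1
  | setNum (a : ℕ) (e : IdxExpr) (x : NumExpr) (s : Store n) :
      Exec f D sz (.setNum a e x) s (s.putNum a (e.eval s) (x.eval s)) (1 + x.cost sz s)
  | clear (R : ℕ) (s : Store n) :
      Exec f D sz (.clear R) s (s.putTeam R ∅) (n + 1)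
  | include_ (R : ℕ) (e : IdxExpr) (s : Store n) :
      Exec f D sz (.include_ R e) s (s.putTeam R (s.team R ∪ agentSet n (e.eval s))) 1
  | exclude (R : ℕ) (e : IdxExpr) (s : Store n) :
      Exec f D sz (.exclude R e) s (s.putTeam R (s.team R \ agentSet n (e.eval s))) 1
  | copy (R R' : ℕ) (s : Store n) :
      Exec f D sz (.copy R R') s (s.putTeam R (s.team R')) (n + 1)
  | value (a : ℕ) (e : IdxExpr) (R : ℕ) (s : Store n) :
      Exec f D sz (.value a e R) s (s.putNum a (e.eval s) (f (s.team R)))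
        (n + 1 + sz (f (s.team R)))
  | demand (R : ℕ) (a : ℕ) (s : Store n) :
      Exec f D sz (.demand R a) s (s.putTeam R (D (fun i => s.num a i)))
        (n + 1 + ∑ i : Fin n, sz (s.num a i))

/-- The initial store: array `0` holds the costs of the agents, everything else is `0` or empty. -/
def Store.init (c : Fin n → ℝ) : Store n where
  idx _ := 0
  num a k := if h : a = 0 ∧ k < n then c ⟨k, h.2⟩ else 0
  team _ := ∅

/-- Output team: the content of set register `0`. -/
def Store.outTeam (s : Store n) : Finset (Fin n) := s.team 0

/-- Output shares: the content of array `1`. -/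
def Store.outShare (s : Store n) : Fin n → ℝ := fun i => s.num 1 i

/-- Unit-cost arithmetic: handling a number takes one step. -/
def unitSize : ℝ → ℕ := fun _ => 1

/-- Bit length of a rational number: that of its reduced numerator and denominator. -/
def ratBits (r : ℚ) : ℕ := Nat.size r.num.natAbs + Nat.size r.den

open Classical in
/-- Bit-cost arithmetic: handling a rational number takes as many steps as it has bits (plus one).
It is used for problems with rational data only, where no irrational number ever arises. -/
def bitSize : ℝ → ℕ := fun x => if h : ∃ r : ℚ, (r : ℝ) = x then 1 + ratBits h.choose else 1

/-- All data of the problem are rational numbers of at most `b` bits. -/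
def Problem.HasBits (I : Problem n) (b : ℕ) : Prop :=
  (∀ i, ∃ r : ℚ, (r : ℝ) = I.c i ∧ ratBits r ≤ b) ∧
  (∀ S, ∃ r : ℚ, (r : ℝ) = I.f S ∧ ratBits r ≤ b)

end TeamContract

end

noncomputable section

namespace TeamContract

variable {n : ℕ}

/-! ### Monotone submodular functions -/

namespace Problem

variable (I : Problem n)

/-! Equal shares are unchanged by a swap, so every non-discriminatory contract is fair
(`IsNonDiscriminatory.isFair`). It therefore suffices to output a non-discriminatory contract whose
revenue is within a constant, here 241, of every fair one.

Fairness almost forces equal shares. After a swap that gives `i` the larger share of `j`, only `j`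
has lost, so every equilibrium still contains `T \ {j}`, and absence of envy gives `β j * f (T \
{j}) ≤ β i * f T` (`IsFair.share_mul_le`). An agent with more than twice the minimal share thus
carries more than half of `f T`, and subadditivity allows only one such agent
(`IsFair.card_large_le_one`). The other agents `A` have shares of at most `2 / |A|`. Splitting `A`
into boundedly many groups of at most `k = ⌊|A| / 8⌋` agents leaves a group `B` with a constant
fraction of `f A` whose members have marginals of at least `4 * k * c i`. So fair revenue is bounded
by single agents and such teams `B` (`IsFair.rev_le`).

A demand query finds a substitute for `B`. The price `2 * k * c i` makes every subset of the
demanded set incentivized at share `1 / (2k)`, so a subset of at most `k` agents leaves half its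
value to the principal. The extra flat price, about `f B / (4k)`, makes each demanded agent
contribute enough that truncation to `k` agents is harmless (`exists_good_query`). The guess of `f
B` is an integer multiple `j ≤ k` of the largest singleton value in `B`, so trying all agents, all
`k` and all `j` costs about `n ^ 3` queries.

For the running time, every number computed is a fixed-size expression in costs, values of `f`,
indices and literals; nothing accumulates over the loops. `Problem.level` records this and holds
vacuously for irrational data, while `Runs` fixes the final store before the cost measure, so one
analysis serves unit cost and bit cost. -/

/-- Removing agents from a team only increases the marginal contributions of the others. -/
theorem marginal_anti {S T : Finset (Fin n)} (h : S ⊆ T) {i : Fin n} (hi : i ∈ S) :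
    I.f T - I.f (T.erase i) ≤ I.f S - I.f (S.erase i) := by
  have := I.f_submodular (S.erase i) (T.erase i) (Finset.erase_subset_erase i h) i
  rwa [Finset.insert_erase hi, Finset.insert_erase (h hi)] at this

theorem f_union_le (A B : Finset (Fin n)) : I.f (A ∪ B) ≤ I.f A + I.f B := by
  induction B using Finset.induction_on with
  | empty => simp [I.f_empty]
  | insert i B hi ih =>
    have := I.f_submodular B (A ∪ B) Finset.subset_union_right i
    rw [Finset.union_insert]
    linarith

theorem f_le_sum_singleton (A : Finset (Fin n)) : I.f A ≤ ∑ i ∈ A, I.f {i} := by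
  induction A using Finset.induction_on with
  | empty => simp [I.f_empty]
  | insert i B hi ih =>
    rw [Finset.sum_insert hi, Finset.insert_eq]
    linarith [I.f_union_le {i} B]

/-- Building `S` up one agent at a time telescopes to `f S`, and each agent adds at least its
marginal contribution to the larger set `T`. -/
theorem sum_marginal_le {S T : Finset (Fin n)} (h : S ⊆ T) :
    ∑ i ∈ S, (I.f T - I.f (T.erase i)) ≤ I.f S := by
  induction S using Finset.induction_on with
  | empty => simp [I.f_empty]
  | insert i S hi ih =>
    rw [Finset.sum_insert hi]
    have h1 := ih ((Finset.subset_insert i S).trans h)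
    have h2 := I.f_submodular S (T.erase i)
      (Finset.subset_erase.2 ⟨(Finset.subset_insert i S).trans h, hi⟩) i
    rw [Finset.insert_erase (h (Finset.mem_insert_self i S))] at h2
    linarith

/-- A team covered by `m` groups of at most `k` agents has a group with an `m`-th of its value. -/
theorem exists_subset_card_le (k m : ℕ) :
    ∀ A : Finset (Fin n), A.card ≤ m * k → 0 < m →
      ∃ B ⊆ A, B.card ≤ k ∧ I.f A ≤ m * I.f B := by
  induction m with
  | zero => intro A _ h; exact absurd h (lt_irrefl 0)
  | succ m ih =>
    intro A hA _
    rcases Nat.eq_zero_or_pos m with rfl | hm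
    · exact ⟨A, subset_rfl, by simpa using hA, by simp⟩
    by_cases hk : A.card ≤ k
    · refine ⟨A, subset_rfl, hk, ?_⟩
      have := I.f_nonneg A
      push_cast
      nlinarith [(Nat.cast_nonneg m : (0 : ℝ) ≤ m)]
    -- Split off one full group `C`; the better of `C` and the group found in the rest is the
    -- answer.
    obtain ⟨C, hCA, hC⟩ := Finset.exists_subset_card_eq (le_of_not_ge hk)
    have hcard : (A \ C).card ≤ m * k := by
      rw [Finset.card_sdiff_of_subset hCA]
      have : (m + 1) * k = m * k + k := by ring
      omega
    obtain ⟨B, hB, hBk, hBf⟩ := ih _ hcard hm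
    have hsub := I.f_union_le C (A \ C)
    rw [Finset.union_sdiff_of_subset hCA] at hsub
    have hm0 : (0 : ℝ) ≤ m := Nat.cast_nonneg m
    rcases le_total (I.f B) (I.f C) with h | h
    · exact ⟨C, hCA, hC.le, by push_cast; nlinarith⟩
    · exact ⟨B, hB.trans Finset.sdiff_subset, hBk, by push_cast; nlinarith⟩

/-! ### Fair contracts -/

/-- The swap changes nothing, so the full team `S` is itself the required equilibrium. -/
theorem IsNonDiscriminatory.isFair {I : Problem n} {S : Finset (Fin n)} {α : Fin n → ℝ}
    (h : I.IsNonDiscriminatory S α) : I.IsFair S α := by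
  refine ⟨h.1, fun i hi j hj => ⟨S, ?_, ?_, ?_⟩⟩
  · have hα : α ∘ Equiv.swap i j = α := by
      funext k
      rw [Function.comp_apply, Equiv.swap_apply_def]
      split_ifs with h1 h2
      · rw [h1, h.2 j hj i hi]
      · rw [h2, h.2 i hi j hj]
      · rfl
    rw [hα]
    exact ⟨subset_rfl, h.1.feasible, by simp⟩
  · simp [hi, h.2 i hi j hj]
  · simp [hj, h.2 i hi j hj]

variable {I}

/-- An agent who has a larger share than another one must be important for the team. -/
theorem IsFair.share_mul_le {T : Finset (Fin n)} {β : Fin n → ℝ} (h : I.IsFair T β)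
    {i j : Fin n} (hi : i ∈ T) (hj : j ∈ T) (hij : β i < β j) :
    β j * I.f (T.erase j) ≤ β i * I.f T := by
  obtain ⟨E, ⟨hET, -, hout⟩, henvy, -⟩ := h.2 i hi j hj
  -- Agents other than `j` keep at least their old share, and their marginals at `E` are at least
  -- those at `T`. Since effort paid off at `T`, none of them can prefer to stay out of `E`.
  have hsub : T.erase j ⊆ E := by
    intro k hk
    obtain ⟨hkj, hkT⟩ := Finset.mem_erase.1 hk
    by_contra hkE
    have h1 := hout k (Finset.mem_sdiff.2 ⟨hkT, hkE⟩)
    have h2 := h.1.feasible k hkT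
    have h3 := I.marginal_anti (Finset.insert_subset hkT hET) (Finset.mem_insert_self k E)
    rw [Finset.erase_insert hkE] at h3
    have h4 : β k ≤ (β ∘ Equiv.swap i j) k := by
      rw [Function.comp_apply, Equiv.swap_apply_def]
      split_ifs with h1
      · rw [h1]; exact hij.le
      · exact le_rfl
    have h5 := (h.1.mem_Icc k hkT).1
    have h6 := I.f_mono E (insert k E) (Finset.subset_insert k E)
    nlinarith [mul_le_mul_of_nonneg_left h3 h5, mul_le_mul_of_nonneg_right h4 (sub_nonneg.2 h6)]
  have hβ := (h.1.mem_Icc j hj).1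
  have h1 := mul_le_mul_of_nonneg_left (I.f_mono _ _ hsub) hβ
  -- In the no-envy inequality of `i` the costs cancel if `i ∈ E`; otherwise the cost only helps.
  have h2 : β j * I.f E ≤ β i * I.f T := by
    have := (I.c_pos i).le
    split_ifs at henvy <;> linarith
  exact h1.trans h2

theorem IsContract.cost_le {S : Finset (Fin n)} {α : Fin n → ℝ} (h : I.IsContract S α)
    {i : Fin n} (hi : i ∈ S) : I.c i ≤ α i * (I.f S - I.f (S.erase i)) := by
  linarith [h.feasible i hi]

theorem IsContract.share_pos {S : Finset (Fin n)} {α : Fin n → ℝ} (h : I.IsContract S α)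
    {i : Fin n} (hi : i ∈ S) : 0 < α i := by
  have := h.cost_le hi
  have h1 := (h.mem_Icc i hi).1
  have h2 := I.c_pos i
  rcases h1.eq_or_lt with h3 | h3
  · rw [← h3] at this; linarith
  · exact h3

/-- By submodularity an incentivized agent stays so when working alone. Hence `(1 - α i) * f {i} ≤ f
{i} - c i`, which charges an agent's value to a one-agent contract. -/
theorem IsContract.cost_le_singleton {S : Finset (Fin n)} {α : Fin n → ℝ}
    (h : I.IsContract S α) {i : Fin n} (hi : i ∈ S) : I.c i ≤ α i * I.f {i} := by
  have h1 := I.marginal_anti (Finset.singleton_subset_iff.2 hi) (Finset.mem_singleton_self i)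
  have h2 : I.f (({i} : Finset (Fin n)).erase i) = 0 := by simp [I.f_empty]
  exact (h.cost_le hi).trans
    (mul_le_mul_of_nonneg_left (by linarith) (h.mem_Icc i hi).1)

/-- The members of a fair team, except for at most one, have the same share up to a factor `2`. -/
theorem IsFair.card_large_le_one {T : Finset (Fin n)} {β : Fin n → ℝ} (h : I.IsFair T β)
    (hf : 0 < I.f T) {i : Fin n} (hi : i ∈ T) :
    (T.filter (fun j => 2 * β i < β j)).card ≤ 1 := by
  have small : ∀ j ∈ T.filter (fun j => 2 * β i < β j), 2 * I.f (T.erase j) < I.f T := by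
    intro j hj
    obtain ⟨hjT, hlt⟩ := Finset.mem_filter.1 hj
    have hpos := h.1.share_pos hi
    have := h.share_mul_le hi hjT (by linarith)
    by_contra hcon
    nlinarith [mul_le_mul_of_nonneg_left (not_lt.1 hcon) (h.1.share_pos hjT).le,
      mul_lt_mul_of_pos_right hlt hf]
  refine Finset.card_le_one.2 fun a ha b hb => ?_
  by_contra hab
  have h1 := small a ha
  have h2 := small b hb
  -- Two sets of value below `f T / 2` would cover `T`, against subadditivity.
  have h3 : T.erase a ∪ T.erase b = T := by
    ext x
    simp only [Finset.mem_union, Finset.mem_erase]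
    grind
  have h4 := I.f_union_le (T.erase a) (T.erase b)
  rw [h3] at h4
  linarith

/-- A bound on single agents and on teams with small equal shares bounds all fair contracts. -/
theorem IsFair.rev_le {T : Finset (Fin n)} {β : Fin n → ℝ} (h : I.IsFair T β) {r : ℝ}
    (hr : 0 ≤ r) (hsingle : ∀ i, I.f {i} - I.c i ≤ r)
    (hteam : ∀ (k : ℕ) (B : Finset (Fin n)), 1 ≤ k → k ≤ n → B.card ≤ k →
      (∀ i ∈ B, 4 * k * I.c i ≤ I.f B - I.f (B.erase i)) → I.f B ≤ 16 * r) :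
    I.rev T β ≤ 241 * r := by
  have hβ0 : ∀ i ∈ T, 0 ≤ β i := fun i hi => (h.1.mem_Icc i hi).1
  by_cases hsum : 1 ≤ ∑ i ∈ T, β i
  · have : I.rev T β ≤ 0 := mul_nonpos_of_nonpos_of_nonneg (by linarith) (I.f_nonneg T)
    linarith
  push Not at hsum
  by_cases hf : I.f T ≤ 0
  · have : I.rev T β ≤ 0 := mul_nonpos_of_nonneg_of_nonpos (by linarith) hf
    linarith
  push Not at hf
  have hne : T.Nonempty := by
    by_contra hcon
    rw [Finset.not_nonempty_iff_eq_empty.1 hcon, I.f_empty] at hf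
    exact lt_irrefl _ hf
  have hagent : ∀ i ∈ T, (1 - ∑ j ∈ T, β j) * I.f {i} ≤ r := by
    intro i hi
    have h1 := h.1.cost_le_singleton hi
    have h2 := Finset.single_le_sum hβ0 hi
    have h3 := I.f_nonneg {i}
    nlinarith [hsingle i]
  obtain ⟨i₀, hi₀, hmin⟩ := T.exists_min_image β hne
  set L := T.filter (fun j => 2 * β i₀ < β j) with hL
  set A := T.filter (fun j => ¬ 2 * β i₀ < β j) with hA
  have hLA : L ∪ A = T := Finset.filter_union_filter_not_eq _ T
  have hAT : A ⊆ T := Finset.filter_subset _ _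
  have hcardL : L.card ≤ 1 := h.card_large_le_one hf hi₀
  have hfL : (1 - ∑ j ∈ T, β j) * I.f L ≤ r := by
    have h1 := I.f_le_sum_singleton L
    have h2 : ∑ i ∈ L, (1 - ∑ j ∈ T, β j) * I.f {i} ≤ L.card • r :=
      Finset.sum_le_card_nsmul _ _ _ fun i hi => hagent i (Finset.filter_subset _ _ hi)
    rw [← Finset.mul_sum, nsmul_eq_mul] at h2
    have h3 : (L.card : ℝ) ≤ 1 := by exact_mod_cast hcardL
    nlinarith
  have hfA : (1 - ∑ j ∈ T, β j) * I.f A ≤ 240 * r := by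
    -- For few agents `⌊|A| / 8⌋` is zero, but then single agents already suffice.
    by_cases hN : A.card < 8
    · have h1 := I.f_le_sum_singleton A
      have h2 : ∑ i ∈ A, (1 - ∑ j ∈ T, β j) * I.f {i} ≤ A.card • r :=
        Finset.sum_le_card_nsmul _ _ _ fun i hi => hagent i (hAT hi)
      rw [← Finset.mul_sum, nsmul_eq_mul] at h2
      have h3 : (A.card : ℝ) ≤ 8 := by exact_mod_cast hN.le
      nlinarith
    push Not at hN
    have hcard : A.card ≤ n := by simpa using Finset.card_le_univ A
    -- With `k = ⌊|A| / 8⌋ ≥ 1`, `|A| ≤ 8k + 7 ≤ 15k`, so 15 groups suffice. The final constant is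
    -- `15 * 16 + 1`, the `1` accounting for the exceptional agent.
    obtain ⟨B, hBA, hBk, hBf⟩ := I.exists_subset_card_le (A.card / 8) 15 A (by omega) (by norm_num)
    have hm := h.1.share_pos hi₀
    have hAm : A.card * β i₀ ≤ 1 := by
      have h1 : A.card • β i₀ ≤ ∑ j ∈ A, β j :=
        Finset.card_nsmul_le_sum _ _ _ fun j hj => hmin j (hAT hj)
      have h2 : ∑ j ∈ A, β j ≤ ∑ j ∈ T, β j :=
        Finset.sum_le_sum_of_subset_of_nonneg hAT fun i hi _ => hβ0 i hi
      rw [nsmul_eq_mul] at h1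
      linarith
    have hk8 : 8 * ((A.card / 8 : ℕ) : ℝ) ≤ A.card := by exact_mod_cast Nat.mul_div_le _ 8
    -- Costs are at most `2 * β i₀` times the marginals, and `8 * k * β i₀ ≤ |A| * β i₀ ≤ 1`; this
    -- gives the factor `4 * k`, twice what the share `1 / (2k)` needs.
    have hB := hteam (A.card / 8) B (by omega) (by omega) hBk (by
      intro i hi
      have hiA := hBA hi
      have hiT := hAT hiA
      have h1 := h.1.cost_le hiT
      have h2 := I.marginal_anti (hBA.trans hAT) hi
      have h3 : β i ≤ 2 * β i₀ := not_lt.1 (Finset.mem_filter.1 hiA).2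
      have h0 : 0 ≤ I.f T - I.f (T.erase i) := sub_nonneg.2 (I.f_mono _ _ (Finset.erase_subset _ _))
      have h4 : I.c i ≤ 2 * β i₀ * (I.f T - I.f (T.erase i)) :=
        h1.trans (mul_le_mul_of_nonneg_right h3 h0)
      have h5 : 8 * ((A.card / 8 : ℕ) : ℝ) * β i₀ ≤ 1 :=
        (mul_le_mul_of_nonneg_right hk8 hm.le).trans hAm
      have h6 := mul_le_mul_of_nonneg_left h4 (by positivity : (0:ℝ) ≤ 4 * (A.card / 8 : ℕ))
      have h7 := mul_le_mul_of_nonneg_right h5 h0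
      linarith)
    have h1 : I.f A ≤ 240 * r := by push_cast at hBf; linarith
    have h2 : 0 ≤ ∑ j ∈ T, β j := Finset.sum_nonneg hβ0
    nlinarith [I.f_nonneg A]
  have hTle := I.f_union_le L A
  rw [hLA] at hTle
  have := mul_le_mul_of_nonneg_left hTle (by linarith : 0 ≤ 1 - ∑ j ∈ T, β j)
  unfold Problem.rev
  linarith

/-! ### Teams from demand queries -/

/-- The prices queried for a target size `k`, a single agent's value `v` and a guess `j * v` of the
value of the team. -/
def price (I : Problem n) (v : ℝ) (k j : ℕ) (i : Fin n) : ℝ :=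
  2 * k * I.c i + j * v / (4 * k)

theorem price_nonneg {v : ℝ} (hv : 0 ≤ v) (k j : ℕ) (i : Fin n) : 0 ≤ I.price v k j i := by
  have := (I.c_pos i).le
  unfold price
  positivity

/-- Dropping `i` from the demanded set is no improvement, so its marginal there covers its price;
passing to the subset `S` only raises the marginal. This is why truncations stay incentivized. -/
theorem price_le_marginal {D : (Fin n → ℝ) → Finset (Fin n)} (hD : IsDemandOracle I.f D)
    {p : Fin n → ℝ} (hp : ∀ i, 0 ≤ p i) {S : Finset (Fin n)} (hS : S ⊆ D p) {i : Fin n}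
    (hi : i ∈ S) : p i ≤ I.f S - I.f (S.erase i) := by
  have h1 := hD p hp ((D p).erase i)
  have h2 := Finset.sum_erase_add (D p) p (hS hi)
  have h3 := I.marginal_anti hS hi
  linarith

/-- For the right parameters, every truncation of the demanded set to size `k` has an eighth
of the value of the team `B`. -/
theorem exists_good_query {D : (Fin n → ℝ) → Finset (Fin n)} (hD : IsDemandOracle I.f D)
    {k : ℕ} (hk : 1 ≤ k) {B : Finset (Fin n)} (hBk : B.card ≤ k)
    (hB : ∀ i ∈ B, 4 * k * I.c i ≤ I.f B - I.f (B.erase i)) (hf : 0 < I.f B) :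
    ∃ (i : Fin n) (j : ℕ), 1 ≤ j ∧ j ≤ k ∧
      ∀ S ⊆ D (I.price (I.f {i}) k j), S = D (I.price (I.f {i}) k j) ∨ S.card = k →
        I.f B ≤ 8 * I.f S := by
  have hne : B.Nonempty := by
    by_contra hcon
    rw [Finset.not_nonempty_iff_eq_empty.1 hcon, I.f_empty] at hf
    exact lt_irrefl _ hf
  obtain ⟨i, hi, hmax⟩ := B.exists_max_image (fun i => I.f {i}) hne
  set v := I.f {i} with hv
  have hk0 : (0 : ℝ) < k := by exact_mod_cast hk
  have hBkR : (B.card : ℝ) ≤ k := by exact_mod_cast hBk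
  have hv0 : 0 ≤ v := I.f_nonneg _
  have hBv : I.f B ≤ k * v := by
    have h1 := I.f_le_sum_singleton B
    have h2 := Finset.sum_le_card_nsmul B (fun i => I.f {i}) v hmax
    rw [nsmul_eq_mul] at h2
    nlinarith
  have hvpos : 0 < v := by
    by_contra hcon
    nlinarith
  have hvB : v ≤ I.f B := I.f_mono _ _ (Finset.singleton_subset_iff.2 hi)
  -- As `v ≤ f B ≤ k * v`, this `j` lies between `1` and `k`, and `j * v` is between `f B / 2` and
  -- `f B`.
  set j := ⌊I.f B / v⌋₊ with hj
  have hj1 : 1 ≤ j := Nat.le_floor (by rw [Nat.cast_one, le_div_iff₀ hvpos]; linarith)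
  have hjk : j ≤ k := by
    have : I.f B / v ≤ k := by rw [div_le_iff₀ hvpos]; exact hBv
    exact Nat.floor_le_of_le this
  have hjle : j * v ≤ I.f B := by
    have := Nat.floor_le (div_nonneg hf.le hvpos.le)
    rwa [le_div_iff₀ hvpos] at this
  have hjlt : I.f B < (j + 1) * v := by
    have := Nat.lt_floor_add_one (I.f B / v)
    rwa [div_lt_iff₀ hvpos] at this
  have hj1R : (1 : ℝ) ≤ j := by exact_mod_cast hj1
  have hhalf : I.f B ≤ 2 * (j * v) := by nlinarith
  refine ⟨i, j, hj1, hjk, fun S hS hcase => ?_⟩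
  have hp : ∀ l, 0 ≤ I.price v k j l := price_nonneg hv0 k j
  have hlam : k * (j * v / (4 * k)) = j * v / 4 := by field_simp
  have hlam0 : 0 ≤ j * v / (4 * k) := by positivity
  rcases hcase with rfl | hcard
  -- Nothing was cut off: compare the demand with `B`. The cost part of the prices of `B` is at most
  -- half its marginals, hence at most `f B / 2`, and the flat part is at most `f B / 4`; a quarter
  -- of `f B` remains.
  · have h1 := hD _ hp B
    have h2 : 0 ≤ ∑ l ∈ D (I.price v k j), I.price v k j l := Finset.sum_nonneg fun l _ => hp l
    have h3 : ∑ l ∈ B, I.price v k j l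
        ≤ ∑ l ∈ B, ((I.f B - I.f (B.erase l)) / 2 + j * v / (4 * k)) := by
      refine Finset.sum_le_sum fun l hl => ?_
      have := hB l hl
      unfold price
      linarith
    rw [Finset.sum_add_distrib, ← Finset.sum_div, Finset.sum_const, nsmul_eq_mul] at h3
    have h4 := I.sum_marginal_le (subset_refl B)
    have h5 := mul_le_mul_of_nonneg_right hBkR hlam0
    linarith
  -- Exactly `k` agents, each with marginal at least `j * v / (4k)`, give `f S ≥ j * v / 4 ≥ f B /
  -- 8`.
  · have h1 := I.sum_marginal_le (subset_refl S)
    have h2 : S.card • (j * v / (4 * k)) ≤ ∑ l ∈ S, (I.f S - I.f (S.erase l)) := by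
      refine Finset.card_nsmul_le_sum _ _ _ fun l hl => ?_
      have h3 := price_le_marginal hD hp hS hl
      have h4 : 0 ≤ 2 * k * I.c l := by have := (I.c_pos l).le; positivity
      unfold price at h3
      linarith
    rw [hcard, nsmul_eq_mul] at h2
    linarith

end Problem

/-! ### Bit lengths -/

theorem size_mul_le (a b : ℕ) : Nat.size (a * b) ≤ Nat.size a + Nat.size b := by
  rw [Nat.size_le, pow_add]
  exact Nat.mul_lt_mul'' (Nat.lt_size_self a) (Nat.lt_size_self b)

theorem size_le_self (a : ℕ) : Nat.size a ≤ a := Nat.size_le.2 a.lt_two_pow_self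

/-- The reduced numerator and denominator divide the given ones, so any representation bounds the
bit length. -/
theorem ratBits_le_of_divInt {x y : ℤ} (hy : y ≠ 0) :
    ratBits (x / y : ℚ) ≤ Nat.size x.natAbs + Nat.size y.natAbs := by
  rw [← Rat.divInt_eq_div]
  refine Nat.add_le_add ?_ ?_
  · apply Nat.size_le_size
    by_cases hx : x = 0
    · simp [hx]
    · exact Nat.le_of_dvd (Int.natAbs_pos.2 hx) (Int.natAbs_dvd_natAbs.2 (Rat.num_dvd x hy))
  · apply Nat.size_le_size
    exact Nat.le_of_dvd (Int.natAbs_pos.2 hy)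
      (by simpa using Int.natAbs_dvd_natAbs.2 (Rat.den_dvd x y))

theorem ratBits_natCast (k : ℕ) : ratBits (k : ℚ) ≤ k + 1 := by
  have h := size_le_self k
  simpa [ratBits] using h

theorem ratBits_mul (x y : ℚ) : ratBits (x * y) ≤ ratBits x + ratBits y := by
  have h : x * y = ((x.num * y.num : ℤ) : ℚ) / ((x.den * y.den : ℤ) : ℚ) := by
    conv_lhs => rw [← x.num_div_den, ← y.num_div_den]
    push_cast
    rw [div_mul_div_comm]
  rw [h]
  refine (ratBits_le_of_divInt (by positivity)).trans ?_
  have h1 := size_mul_le x.num.natAbs y.num.natAbs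
  have h2 := size_mul_le x.den y.den
  rw [Int.natAbs_mul, Int.natAbs_mul, Int.natAbs_natCast, Int.natAbs_natCast]
  unfold ratBits
  omega

theorem ratBits_inv (x : ℚ) : ratBits x⁻¹ ≤ ratBits x := by
  by_cases hx : x = 0
  · simp [hx]
  have h : x⁻¹ = ((x.den : ℤ) : ℚ) / (x.num : ℚ) := by
    conv_lhs => rw [← x.num_div_den]
    simp
  rw [h]
  refine (ratBits_le_of_divInt (Rat.num_ne_zero.2 hx)).trans ?_
  rw [Int.natAbs_natCast]
  unfold ratBits
  omega

theorem ratBits_neg (x : ℚ) : ratBits (-x) = ratBits x := by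
  simp [ratBits]

/-- Over the product denominator, numerator and denominator can each take the total length of both
inputs; the sum in the numerator adds one carry bit. -/
theorem ratBits_add (x y : ℚ) : ratBits (x + y) ≤ 2 * (ratBits x + ratBits y) + 1 := by
  have h : x + y = ((x.num * y.den + x.den * y.num : ℤ) : ℚ) / ((x.den * y.den : ℤ) : ℚ) := by
    conv_lhs => rw [← x.num_div_den, ← y.num_div_den]
    push_cast
    rw [div_add_div _ _ (by positivity) (by positivity)]
  rw [h]
  refine (ratBits_le_of_divInt (by positivity)).trans ?_
  have h2 := size_mul_le x.den y.den
  have h3 : Nat.size (x.num * y.den + x.den * y.num).natAbs ≤ ratBits x + ratBits y + 1 := by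
    refine (Nat.size_le_size (Int.natAbs_add_le _ _)).trans (Nat.size_le.2 ?_)
    rw [Int.natAbs_mul, Int.natAbs_mul, Int.natAbs_natCast, Int.natAbs_natCast, pow_succ, mul_two]
    have h4 : Nat.size (x.num.natAbs * y.den) ≤ ratBits x + ratBits y :=
      (size_mul_le _ _).trans (by unfold ratBits; omega)
    have h5 : Nat.size (x.den * y.num.natAbs) ≤ ratBits x + ratBits y :=
      (size_mul_le _ _).trans (by unfold ratBits; omega)
    exact Nat.add_lt_add (Nat.size_le.1 h4) (Nat.size_le.1 h5)
  rw [Int.natAbs_mul, Int.natAbs_natCast, Int.natAbs_natCast]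
  unfold ratBits at *
  omega

theorem bitSize_ratCast (r : ℚ) : bitSize (r : ℝ) = 1 + ratBits r := by
  have h : ∃ r' : ℚ, (r' : ℝ) = r := ⟨r, rfl⟩
  rw [bitSize, dif_pos h]
  congr 2
  exact_mod_cast h.choose_spec

/-- The numbers whose bit length is at most `a` times the input length, if the data are rational. -/
def Problem.level (I : Problem n) (a : ℕ) : Set ℝ :=
  {x | ∀ b, I.HasBits b → ∃ r : ℚ, (r : ℝ) = x ∧ ratBits r ≤ a * (n + b + 1)}

/-! ### Closure of the linear bit-length bounds under arithmetic -/

section Level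

variable {I : Problem n} {a a' : ℕ} {x y : ℝ}

theorem level_mono (h : a ≤ a') (hx : x ∈ I.level a) : x ∈ I.level a' := by
  intro b hb
  obtain ⟨r, hr, hr'⟩ := hx b hb
  exact ⟨r, hr, hr'.trans (Nat.mul_le_mul_right _ h)⟩

theorem c_mem_level (i : Fin n) : I.c i ∈ I.level 1 := by
  intro b hb
  obtain ⟨r, hr, hr'⟩ := hb.1 i
  exact ⟨r, hr, by omega⟩

theorem f_mem_level (S : Finset (Fin n)) : I.f S ∈ I.level 1 := by
  intro b hb
  obtain ⟨r, hr, hr'⟩ := hb.2 S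
  exact ⟨r, hr, by omega⟩

/-- The crude bound of `k + 1` bits suffices, since only indices up to `n` and small literals occur.
-/
theorem natCast_mem_level {k m : ℕ} (hk : k ≤ n + m) : (k : ℝ) ∈ I.level (m + 1) := by
  intro b _
  refine ⟨k, by simp, (ratBits_natCast k).trans ?_⟩
  nlinarith

theorem mul_mem_level (hx : x ∈ I.level a) (hy : y ∈ I.level a') :
    x * y ∈ I.level (a + a') := by
  intro b hb
  obtain ⟨r, rfl, hr⟩ := hx b hb
  obtain ⟨q, rfl, hq⟩ := hy b hb
  refine ⟨r * q, by push_cast; rfl, (ratBits_mul r q).trans ?_⟩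
  rw [add_mul]
  omega

theorem div_mem_level (hx : x ∈ I.level a) (hy : y ∈ I.level a') :
    x / y ∈ I.level (a + a') := by
  rw [div_eq_mul_inv]
  refine mul_mem_level hx fun b hb => ?_
  obtain ⟨q, rfl, hq⟩ := hy b hb
  exact ⟨q⁻¹, by push_cast; rfl, (ratBits_inv q).trans hq⟩

theorem add_mem_level (hx : x ∈ I.level a) (hy : y ∈ I.level a') :
    x + y ∈ I.level (2 * (a + a') + 1) := by
  intro b hb
  obtain ⟨r, rfl, hr⟩ := hx b hb
  obtain ⟨q, rfl, hq⟩ := hy b hb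
  refine ⟨r + q, by push_cast; rfl, (ratBits_add r q).trans ?_⟩
  nlinarith

theorem sub_mem_level (hx : x ∈ I.level a) (hy : y ∈ I.level a') :
    x - y ∈ I.level (2 * (a + a') + 1) := by
  rw [sub_eq_add_neg]
  refine add_mem_level hx fun b hb => ?_
  obtain ⟨q, rfl, hq⟩ := hy b hb
  exact ⟨-q, by push_cast; rfl, (ratBits_neg q).le.trans hq⟩

theorem bitSize_le_of_mem_level {b : ℕ} (hb : I.HasBits b) (hx : x ∈ I.level a) :
    bitSize x ≤ 1 + a * (n + b + 1) := by
  obtain ⟨r, rfl, hr⟩ := hx b hb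
  rw [bitSize_ratCast]
  omega

end Level

/-! ### Running programs -/

/-- All numbers that arise in the evaluation of an expression belong to `G`. -/
def NumExpr.Within (G : Set ℝ) (s : Store n) : NumExpr → Prop
  | .lit r => (r : ℝ) ∈ G
  | .entry a e => s.num a (e.eval s) ∈ G
  | .ofIdx e => (e.eval s : ℝ) ∈ G
  | .add x y => x.Within G s ∧ y.Within G s ∧ x.eval s + y.eval s ∈ G
  | .sub x y => x.Within G s ∧ y.Within G s ∧ x.eval s - y.eval s ∈ G
  | .mul x y => x.Within G s ∧ y.Within G s ∧ x.eval s * y.eval s ∈ G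
  | .div x y => x.Within G s ∧ y.Within G s ∧ x.eval s / y.eval s ∈ G

/-- The number of nodes of an expression. -/
def NumExpr.nodes : NumExpr → ℕ
  | .lit _ => 1
  | .entry _ _ => 1
  | .ofIdx _ => 1
  | .add x y => x.nodes + y.nodes + 1
  | .sub x y => x.nodes + y.nodes + 1
  | .mul x y => x.nodes + y.nodes + 1
  | .div x y => x.nodes + y.nodes + 1

theorem NumExpr.cost_le {G : Set ℝ} {sz : ℝ → ℕ} {M : ℕ} (h : ∀ x ∈ G, sz x ≤ M) (s : Store n)
    (x : NumExpr) (hx : x.Within G s) : x.cost sz s ≤ x.nodes * M := by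
  induction x with
  | lit r => simpa [cost, nodes] using h _ hx
  | entry a e => simpa [cost, nodes] using h _ hx
  | ofIdx e => simpa [cost, nodes] using h _ hx
  | add x y hx' hy' | sub x y hx' hy' | mul x y hx' hy' | div x y hx' hy' =>
    have h1 := hx' hx.1
    have h2 := hy' hx.2.1
    have h3 := h _ hx.2.2
    simp only [cost, nodes, add_mul, one_mul]
    omega

/-- All numbers that arise in the evaluation of a test belong to `G`. -/
def Test.Within (G : Set ℝ) (s : Store n) : Test → Prop
  | .idxLt _ _ => True
  | .numLe x y => x.Within G s ∧ y.Within G s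
  | .isMember _ _ => True
  | .neg b => b.Within G s

/-- The number of nodes of a test. -/
def Test.nodes : Test → ℕ
  | .idxLt _ _ => 1
  | .numLe x y => 1 + x.nodes + y.nodes
  | .isMember _ _ => 1
  | .neg b => 1 + b.nodes

theorem Test.cost_le {G : Set ℝ} {sz : ℝ → ℕ} {M : ℕ} (hM : 1 ≤ M) (h : ∀ x ∈ G, sz x ≤ M)
    (s : Store n) (b : Test) (hb : b.Within G s) : b.cost sz s ≤ b.nodes * M := by
  induction b with
  | idxLt e e' => simpa [cost, nodes] using hM
  | isMember e R => simpa [cost, nodes] using hM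
  | numLe x y =>
    have h1 := x.cost_le h s hb.1
    have h2 := y.cost_le h s hb.2
    simp only [cost, nodes, add_mul, one_mul]
    omega
  | neg b ih =>
    have := ih hb
    simp only [cost, nodes, add_mul, one_mul]
    omega

section Runs

variable (f : Finset (Fin n) → ℝ) (D : (Fin n → ℝ) → Finset (Fin n)) (G : Set ℝ)

/-- Program `P` leads from `s` to `s'` in at most `T` steps on numbers of `G`: whenever handling
these takes time at most `M`, the running time is at most `T * M`. -/
def Runs (P : Prog) (s s' : Store n) (T : ℕ) : Prop :=
  ∀ (sz : ℝ → ℕ) (M : ℕ), 1 ≤ M → (∀ x ∈ G, sz x ≤ M) →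
    ∃ t, Exec f D sz P s s' t ∧ t ≤ T * M

variable {f D G} {s s' s'' : Store n} {P Q : Prog} {T T' : ℕ}

namespace Runs

theorem mono (h : Runs f D G P s s' T) (hT : T ≤ T') : Runs f D G P s s' T' := by
  intro sz M hM hG
  obtain ⟨t, ht, hle⟩ := h sz M hM hG
  exact ⟨t, ht, hle.trans (Nat.mul_le_mul_right _ hT)⟩

theorem skip : Runs f D G .skip s s 1 :=
  fun _ _ hM _ => ⟨_, Exec.skip s, by omega⟩

theorem seq (h : Runs f D G P s s' T) (h' : Runs f D G Q s' s'' T') :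
    Runs f D G (.seq P Q) s s'' (T + T') := by
  intro sz M hM hG
  obtain ⟨t, ht, hle⟩ := h sz M hM hG
  obtain ⟨t', ht', hle'⟩ := h' sz M hM hG
  exact ⟨_, ht.seq ht', by rw [add_mul]; omega⟩

theorem cond_true {b : Test} (hb : b.holds s) (hw : b.Within G s) (h : Runs f D G P s s' T) :
    Runs f D G (.cond b P Q) s s' (b.nodes + T) := by
  intro sz M hM hG
  obtain ⟨t, ht, hle⟩ := h sz M hM hG
  have := b.cost_le hM hG s hw
  exact ⟨_, Exec.cond_true hb ht, by rw [add_mul]; omega⟩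

theorem cond_false {b : Test} (hb : ¬ b.holds s) (hw : b.Within G s) (h : Runs f D G Q s s' T) :
    Runs f D G (.cond b P Q) s s' (b.nodes + T) := by
  intro sz M hM hG
  obtain ⟨t, ht, hle⟩ := h sz M hM hG
  have := b.cost_le hM hG s hw
  exact ⟨_, Exec.cond_false hb ht, by rw [add_mul]; omega⟩

theorem setIdx (i : ℕ) (e : IdxExpr) : Runs f D G (.setIdx i e) s (s.putIdx i (e.eval s)) 1 :=
  fun _ _ hM _ => ⟨_, Exec.setIdx i e s, by omega⟩

theorem setNum (a : ℕ) (e : IdxExpr) (x : NumExpr) (hx : x.Within G s) :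
    Runs f D G (.setNum a e x) s (s.putNum a (e.eval s) (x.eval s)) (1 + x.nodes) := by
  intro sz M hM hG
  have := x.cost_le hG s hx
  exact ⟨_, Exec.setNum a e x s, by rw [add_mul]; omega⟩

theorem clear (R : ℕ) : Runs f D G (.clear R) s (s.putTeam R ∅) (n + 1) :=
  fun _ _ hM _ => ⟨_, Exec.clear R s, Nat.le_mul_of_pos_right _ hM⟩

theorem include_ (R : ℕ) (e : IdxExpr) : Runs f D G (.include_ R e) s
    (s.putTeam R (s.team R ∪ agentSet n (e.eval s))) 1 :=
  fun _ _ hM _ => ⟨_, Exec.include_ R e s, by omega⟩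

theorem copy (R R' : ℕ) : Runs f D G (.copy R R') s (s.putTeam R (s.team R')) (n + 1) :=
  fun _ _ hM _ => ⟨_, Exec.copy R R' s, Nat.le_mul_of_pos_right _ hM⟩

theorem value (a : ℕ) (e : IdxExpr) (R : ℕ) (h : f (s.team R) ∈ G) :
    Runs f D G (.value a e R) s (s.putNum a (e.eval s) (f (s.team R))) (n + 2) := by
  intro sz M hM hG
  have h1 := hG _ h
  have h2 : n + 1 ≤ (n + 1) * M := Nat.le_mul_of_pos_right _ hM
  refine ⟨_, Exec.value a e R s, ?_⟩
  rw [show n + 2 = n + 1 + 1 from rfl, add_mul (n + 1)]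
  omega

theorem demand (R a : ℕ) (h : ∀ i : Fin n, s.num a i ∈ G) : Runs f D G (.demand R a) s
    (s.putTeam R (D (fun i => s.num a i))) (2 * n + 1) := by
  intro sz M hM hG
  have h1 : ∑ i : Fin n, sz (s.num a i) ≤ n * M := by
    simpa using Finset.sum_le_card_nsmul Finset.univ (fun i : Fin n => sz (s.num a i)) M
      fun i _ => hG _ (h i)
  have h2 : n + 1 ≤ (n + 1) * M := Nat.le_mul_of_pos_right _ hM
  refine ⟨_, Exec.demand R a s, ?_⟩
  rw [show 2 * n + 1 = n + 1 + n by ring, add_mul (n + 1)]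
  omega

end Runs

/-- `for r = 0, …, n - 1 do P`. -/
def forAgents (r : ℕ) (P : Prog) : Prog :=
  .seq (.setIdx r (.lit 0))
    (.loop (.idxLt (.reg r) .agents) (.seq P (.setIdx r (.succ (.reg r)))))

/-- Loops over the agents are analysed by means of an invariant. -/
theorem exists_runs_forAgents {r : ℕ} (Inv : ℕ → Store n → Prop) (h0 : Inv 0 (s.putIdx r 0))
    (hstep : ∀ k < n, ∀ s : Store n, s.idx r = k → Inv k s →
      ∃ s', Runs f D G P s s' T ∧ s'.idx r = k ∧ Inv (k + 1) (s'.putIdx r (k + 1))) :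
    ∃ s', Runs f D G (forAgents r P) s s' (n * (T + 2) + 2) ∧ Inv n s' := by
  -- Induction on the number `m` of remaining rounds. Each round pays `T` for the body, one step for
  -- the test and one for the increment.
  have key : ∀ m k, k + m = n → ∀ s : Store n, s.idx r = k → Inv k s →
      ∃ s', Runs f D G (.loop (.idxLt (.reg r) .agents) (.seq P (.setIdx r (.succ (.reg r)))))
        s s' (m * (T + 2) + 1) ∧ Inv n s' := by
    intro m
    induction m with
    | zero =>
      intro k hk s hs hI
      refine ⟨s, fun sz M hM hG => ⟨_, Exec.loop_false ?_, ?_⟩, ?_⟩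
      · simp only [Test.holds, IdxExpr.eval]; omega
      · simpa [Test.cost] using hM
      · rwa [show n = k by omega]
    | succ m ih =>
      intro k hk s hs hI
      obtain ⟨s₁, hrun, hs₁, hI₁⟩ := hstep k (by omega) s hs hI
      obtain ⟨s₂, hrun₂, hI₂⟩ := ih (k + 1) (by omega) _ (by simp [Store.putIdx]) hI₁
      refine ⟨s₂, fun sz M hM hG => ?_, hI₂⟩
      obtain ⟨t, ht, hle⟩ := hrun sz M hM hG
      obtain ⟨t', ht', hle'⟩ := hrun₂ sz M hM hG
      have hset := Exec.setIdx (f := f) (D := D) (sz := sz) r (.succ (.reg r)) s₁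
      simp only [IdxExpr.eval, hs₁] at hset
      refine ⟨_, Exec.loop_true ?_ (ht.seq hset) ht', ?_⟩
      · simp only [Test.holds, IdxExpr.eval]; omega
      · simp only [Test.cost]
        have h1 : ((m + 1) * (T + 2) + 1) * M = (m * (T + 2) + 1) * M + T * M + 2 * M := by ring
        omega
  obtain ⟨s', hrun, hI⟩ := key n 0 (by omega) _ (by simp [Store.putIdx]) h0
  refine ⟨s', ?_, hI⟩
  have := (Runs.setIdx (f := f) (D := D) (G := G) (s := s) r (.lit 0)).seq hrun
  exact this.mono (by omega)

end Runs

/-! ### The algorithm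

Array `2` and `3` hold, at entry `0`, the common share and a lower bound on the revenue of the best
contract found so far, whose team is in set register `0`.  Entry `0` of array `4` is the value of a
single agent, array `5` contains prices, and set register `1` and entry `0` of the arrays `7` and
`6` contain the team, the share and the guaranteed revenue of a new candidate. -/

/-- Replace the best contract by the candidate if the latter is better. -/
def updateBest : Prog :=
  .cond (.neg (.numLe (.entry 6 (.lit 0)) (.entry 3 (.lit 0))))
    (.seq (.copy 0 1) (.seq (.setNum 2 (.lit 0) (.entry 7 (.lit 0)))
      (.setNum 3 (.lit 0) (.entry 6 (.lit 0)))))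
    .skip

/-- The number `k` of the target size. -/
def sizeExpr : NumExpr := .ofIdx (.succ (.reg 1))

/-- The price of the agent in index register `3`. -/
def priceExpr : NumExpr :=
  .add (.mul (.mul (.lit 2) sizeExpr) (.entry 0 (.reg 3)))
    (.div (.mul (.ofIdx (.succ (.reg 2))) (.entry 4 (.lit 0))) (.mul (.lit 4) sizeExpr))

/-- Compute the prices. -/
def setPrices : Prog := forAgents 3 (.setNum 5 (.reg 3) priceExpr)

/-- Put the agent in index register `3` into the truncated set if it was demanded and
there is room for it. -/
def truncateStep : Prog :=
  .cond (.isMember (.reg 3) 2)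
    (.cond (.idxLt (.reg 4) (.succ (.reg 1)))
      (.seq (.include_ 1 (.reg 3)) (.setIdx 4 (.succ (.reg 4)))) .skip)
    .skip

/-- Truncate the demanded set to the target size. -/
def truncate : Prog := .seq (.clear 1) (.seq (.setIdx 4 (.lit 0)) (forAgents 3 truncateStep))

/-- Evaluate the candidate that consists of the truncated set. -/
def evalCandidate : Prog :=
  .seq (.value 6 (.lit 0) 1)
    (.seq (.setNum 6 (.lit 0) (.div (.entry 6 (.lit 0)) (.lit 2)))
      (.setNum 7 (.lit 0) (.div (.lit 1) (.mul (.lit 2) sizeExpr))))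

/-- Try the candidate that results from a demand query. -/
def tryQuery : Prog :=
  .seq setPrices (.seq (.demand 2 5) (.seq truncate (.seq evalCandidate updateBest)))

/-- Try the candidate that consists of the agent in index register `0`. -/
def trySingle : Prog :=
  .seq (.clear 1) (.seq (.include_ 1 (.reg 0)) (.seq (.value 4 (.lit 0) 1)
    (.seq (.setNum 6 (.lit 0) (.sub (.entry 4 (.lit 0)) (.entry 0 (.reg 0))))
      (.seq (.setNum 7 (.lit 0) (.div (.entry 0 (.reg 0)) (.entry 4 (.lit 0)))) updateBest))))

/-- Write the shares of the best contract to the output array. -/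
def writeShares : Prog :=
  forAgents 3 (.cond (.isMember (.reg 3) 0) (.setNum 1 (.reg 3) (.entry 2 (.lit 0))) .skip)

/-- The approximation algorithm. -/
def algorithm : Prog :=
  .seq (forAgents 0 (.seq trySingle (forAgents 1 (forAgents 2 tryQuery)))) writeShares

/-! ### Analysis of the algorithm -/

/-- The team `S` with common share `a` is incentivized. -/
structure Problem.Feasible (I : Problem n) (S : Finset (Fin n)) (a : ℝ) : Prop where
  nonneg : 0 ≤ a
  le_one : a ≤ 1
  cost_le : ∀ i ∈ S, I.c i ≤ a * (I.f S - I.f (S.erase i))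

/-- The stored best contract is feasible and guarantees the stored revenue. -/
structure Problem.Sound (I : Problem n) (s : Store n) : Prop where
  costs : ∀ l : Fin n, s.num 0 l = I.c l
  out : ∀ l : ℕ, s.num 1 l = 0
  feasible : I.Feasible (s.team 0) (s.num 2 0)
  nonneg : 0 ≤ s.num 3 0
  le_rev : s.num 3 0 ≤ (1 - (s.team 0).card * s.num 2 0) * I.f (s.team 0)
  share_mem : s.num 2 0 ∈ I.level 40
  value_mem : s.num 3 0 ∈ I.level 40

/-- The stored revenue is at least half the value of some truncation of the demanded set. -/
def Problem.Tried (I : Problem n) (D : (Fin n → ℝ) → Finset (Fin n)) (v : ℝ) (k j : ℕ)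
    (r : ℝ) : Prop :=
  ∃ S ⊆ D (I.price v k j), (S = D (I.price v k j) ∨ S.card = k) ∧ I.f S ≤ 2 * r

theorem Problem.Tried.mono {I : Problem n} {D : (Fin n → ℝ) → Finset (Fin n)} {v : ℝ} {k j : ℕ}
    {r r' : ℝ} (h : I.Tried D v k j r) (hr : r ≤ r') : I.Tried D v k j r' := by
  obtain ⟨S, h1, h2, h3⟩ := h
  exact ⟨S, h1, h2, by linarith⟩

/-- The stores agree outside of the work space of a single candidate. -/
structure SameCore (s s' : Store n) : Prop where
  num : ∀ a < 5, s'.num a = s.num a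
  team : s'.team 0 = s.team 0
  idx : ∀ r < 3, s'.idx r = s.idx r

theorem SameCore.trans {s s' s'' : Store n} (h : SameCore s s') (h' : SameCore s' s'') :
    SameCore s s'' :=
  ⟨fun a ha => (h'.num a ha).trans (h.num a ha), h'.team.trans h.team,
    fun r hr => (h'.idx r hr).trans (h.idx r hr)⟩

theorem sameCore_putIdx {s : Store n} {r k : ℕ} (hr : 3 ≤ r) : SameCore s (s.putIdx r k) :=
  ⟨fun _ _ => rfl, rfl, fun r' hr' => Function.update_of_ne (by omega) _ _⟩

theorem sameCore_putNum {s : Store n} {a k : ℕ} {x : ℝ} (ha : 5 ≤ a) :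
    SameCore s (s.putNum a k x) :=
  ⟨fun a' ha' => Function.update_of_ne (by omega) _ _, rfl, fun _ _ => rfl⟩

theorem sameCore_putTeam {s : Store n} {R : ℕ} {S : Finset (Fin n)} (hR : 1 ≤ R) :
    SameCore s (s.putTeam R S) :=
  ⟨fun _ _ => rfl, Function.update_of_ne (by omega) _ _, fun _ _ => rfl⟩

section Sound

variable {I : Problem n} {D : (Fin n → ℝ) → Finset (Fin n)} {s s' : Store n}

theorem Problem.Sound.congr (h : I.Sound s) (hnum : ∀ a < 4, s'.num a = s.num a)
    (hteam : s'.team 0 = s.team 0) : I.Sound s' := by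
  have h0 := hnum 0 (by norm_num)
  have h1 := hnum 1 (by norm_num)
  have h2 := hnum 2 (by norm_num)
  have h3 := hnum 3 (by norm_num)
  constructor <;> simp only [h0, h1, h2, h3, hteam]
  exacts [h.costs, h.out, h.feasible, h.nonneg, h.le_rev, h.share_mem, h.value_mem]

theorem Problem.Sound.of_sameCore (h : I.Sound s) (hs : SameCore s s') : I.Sound s' :=
  h.congr (fun a ha => hs.num a (by omega)) hs.team

theorem lit_mem_level (k : ℕ) (hk : k ≤ 4) : (k : ℝ) ∈ I.level 5 :=
  level_mono (by omega) (natCast_mem_level (m := k) (by omega))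

/-- The candidate must be valid only if it wins, that is, if its revenue beats the stored one.
Meaningless candidates, such as a quotient by zero, are thereby discarded. -/
theorem exists_runs_updateBest (h : I.Sound s)
    (hcand : 0 ≤ s.num 6 0 → s.num 3 0 < s.num 6 0 → I.Feasible (s.team 1) (s.num 7 0) ∧
      s.num 6 0 ≤ (1 - (s.team 1).card * s.num 7 0) * I.f (s.team 1))
    (h6 : s.num 6 0 ∈ I.level 40) (h7 : s.num 7 0 ∈ I.level 40) :
    ∃ s', Runs I.f D (I.level 40) updateBest s s' (n + 9) ∧ I.Sound s' ∧ s'.idx = s.idx ∧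
      s'.num 4 = s.num 4 ∧ s.num 3 0 ≤ s'.num 3 0 ∧ s.num 6 0 ≤ s'.num 3 0 := by
  by_cases hle : s.num 6 0 ≤ s.num 3 0
  · refine ⟨s, (Runs.cond_false ?_ ?_ Runs.skip).mono ?_, h, rfl, rfl, le_rfl, hle⟩
    · simpa [Test.holds, NumExpr.eval, IdxExpr.eval] using hle
    · exact ⟨h6, h.value_mem⟩
    · simp only [Test.nodes, NumExpr.nodes]; omega
  · have hlt := not_le.1 hle
    obtain ⟨hf, hrev⟩ := hcand (h.nonneg.trans hlt.le) hlt
    refine ⟨_, (Runs.cond_true ?_ ?_ ((Runs.copy 0 1).seq ((Runs.setNum 2 (.lit 0)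
      (.entry 7 (.lit 0)) ?_).seq (Runs.setNum 3 (.lit 0) (.entry 6 (.lit 0)) ?_)))).mono ?_,
      ⟨?_, ?_, ?_, ?_, ?_, ?_, ?_⟩, rfl, ?_, ?_, ?_⟩
    · simpa [Test.holds, NumExpr.eval, IdxExpr.eval] using hle
    · exact ⟨h6, h.value_mem⟩
    · exact h7
    · simpa [NumExpr.Within, IdxExpr.eval, Store.putNum, Store.putTeam] using h6
    · simp only [Test.nodes, NumExpr.nodes]; omega
    · simpa [Store.putNum, Store.putTeam] using h.costs
    · simpa [Store.putNum, Store.putTeam] using h.out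
    · simpa [NumExpr.eval, IdxExpr.eval, Store.putNum, Store.putTeam] using hf
    · simpa [NumExpr.eval, IdxExpr.eval, Store.putNum, Store.putTeam] using h.nonneg.trans hlt.le
    · simpa [NumExpr.eval, IdxExpr.eval, Store.putNum, Store.putTeam] using hrev
    · simpa [NumExpr.eval, IdxExpr.eval, Store.putNum, Store.putTeam] using h7
    · simpa [NumExpr.eval, IdxExpr.eval, Store.putNum, Store.putTeam] using h6
    · simp [Store.putNum, Store.putTeam]
    · simpa [NumExpr.eval, IdxExpr.eval, Store.putNum, Store.putTeam] using hlt.le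
    · simp [NumExpr.eval, IdxExpr.eval, Store.putNum, Store.putTeam]

theorem succ_mem_level {k : ℕ} (hk : k < n) : ((k + 1 : ℕ) : ℝ) ∈ I.level 1 :=
  natCast_mem_level (m := 0) (by omega)

theorem exists_runs_setPrices (h : I.Sound s) {k j : ℕ} (hk : k < n) (hj : j < n)
    (h1 : s.idx 1 = k) (h2 : s.idx 2 = j) (hv : s.num 4 0 ∈ I.level 1) :
    ∃ s', Runs I.f D (I.level 40) setPrices s s' (n * 16 + 2) ∧ SameCore s s' ∧
      ∀ l : Fin n, s'.num 5 l = I.price (s.num 4 0) (k + 1) (j + 1) l ∧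
        s'.num 5 l ∈ I.level 40 := by
  obtain ⟨s', hrun, hI⟩ := exists_runs_forAgents (f := I.f) (D := D) (G := I.level 40)
    (s := s) (r := 3) (P := .setNum 5 (.reg 3) priceExpr) (T := 14)
    (fun m s' => SameCore s s' ∧ ∀ l : Fin n, (l : ℕ) < m →
      s'.num 5 l = I.price (s.num 4 0) (k + 1) (j + 1) l ∧ s'.num 5 l ∈ I.level 40)
    ⟨sameCore_putIdx le_rfl, fun l hl => absurd hl (by omega)⟩
    (by
      rintro m hm s₁ hs₁ ⟨hcore, hprices⟩
      have hc : s₁.num 0 m = I.c ⟨m, hm⟩ := (h.of_sameCore hcore).costs ⟨m, hm⟩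
      have e1 : s₁.idx 1 = k := (hcore.idx 1 (by norm_num)).trans h1
      have e2 : s₁.idx 2 = j := (hcore.idx 2 (by norm_num)).trans h2
      have e4 : s₁.num 4 = s.num 4 := hcore.num 4 (by norm_num)
      have lk : ((k + 1 : ℕ) : ℝ) ∈ I.level 1 := succ_mem_level hk
      have lj : ((j + 1 : ℕ) : ℝ) ∈ I.level 1 := succ_mem_level hj
      have lc : I.c ⟨m, hm⟩ ∈ I.level 1 := c_mem_level _
      have l2 : ((2 : ℚ) : ℝ) ∈ I.level 5 := by exact_mod_cast lit_mem_level 2 (by norm_num)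
      have l4 : ((4 : ℚ) : ℝ) ∈ I.level 5 := by exact_mod_cast lit_mem_level 4 (by norm_num)
      -- The levels grow to 31 at `m6`, the largest number arising anywhere; hence the bound 40.
      have m1 := mul_mem_level l2 lk
      have m2 := mul_mem_level m1 lc
      have m3 := mul_mem_level lj hv
      have m4 := mul_mem_level l4 lk
      have m5 := div_mem_level m3 m4
      have m6 := add_mem_level m2 m5
      have heval : priceExpr.eval s₁ = I.price (s.num 4 0) (k + 1) (j + 1) ⟨m, hm⟩ := by
        simp [priceExpr, sizeExpr, NumExpr.eval, IdxExpr.eval, Problem.price, hs₁, hc, e1, e2, e4]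
      have hmem : priceExpr.eval s₁ ∈ I.level 40 := by
        simp only [priceExpr, sizeExpr, NumExpr.eval, IdxExpr.eval, hs₁, hc, e1, e2, e4]
        exact level_mono (by norm_num) m6
      refine ⟨_, (Runs.setNum 5 (.reg 3) priceExpr ?_).mono ?_, ?_, ?_, ?_⟩
      · simp only [priceExpr, sizeExpr, NumExpr.Within, NumExpr.eval, IdxExpr.eval, hs₁, hc, e1,
          e2, e4]
        refine ⟨⟨⟨?_, ?_, ?_⟩, ?_, ?_⟩, ⟨⟨?_, ?_, ?_⟩, ⟨?_, ?_, ?_⟩, ?_⟩, ?_⟩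
        exacts [level_mono (by norm_num) l2, level_mono (by norm_num) lk,
          level_mono (by norm_num) m1, level_mono (by norm_num) lc, level_mono (by norm_num) m2,
          level_mono (by norm_num) lj, level_mono (by norm_num) hv, level_mono (by norm_num) m3,
          level_mono (by norm_num) l4, level_mono (by norm_num) lk, level_mono (by norm_num) m4,
          level_mono (by norm_num) m5, level_mono (by norm_num) m6]
      · simp [priceExpr, sizeExpr, NumExpr.nodes]
      · simpa [Store.putNum] using hs₁
      · exact (hcore.trans (sameCore_putNum le_rfl)).trans (sameCore_putIdx le_rfl)
      · intro l hl
        by_cases hlm : (l : ℕ) = m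
        · have : l = ⟨m, hm⟩ := Fin.ext hlm
          subst this
          have hput : ((s₁.putNum 5 (IdxExpr.eval s₁ (.reg 3)) (priceExpr.eval s₁)).putIdx 3
              (m + 1)).num 5 m = priceExpr.eval s₁ := by
            simp [Store.putNum, Store.putIdx, IdxExpr.eval, hs₁]
          rw [hput]
          exact ⟨heval, hmem⟩
        · have hput : ((s₁.putNum 5 (IdxExpr.eval s₁ (.reg 3)) (priceExpr.eval s₁)).putIdx 3
              (m + 1)).num 5 l = s₁.num 5 l := by
            simp [Store.putNum, Store.putIdx, IdxExpr.eval, hs₁, hlm]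
          rw [hput]
          exact hprices l (by omega))
  exact ⟨s', hrun, hI.1, fun l => hI.2 l l.2⟩

theorem agentSet_val (i : Fin n) : agentSet n i = {i} := by
  ext x
  simp [agentSet, Fin.ext_iff]

theorem exists_runs_truncate {k : ℕ} (h1 : s.idx 1 = k) :
    ∃ s', Runs I.f D (I.level 40) truncate s s' (7 * n + 6) ∧ SameCore s s' ∧
      s'.team 1 ⊆ s.team 2 ∧ (s'.team 1).card ≤ k + 1 ∧
      (s'.team 1 = s.team 2 ∨ (s'.team 1).card = k + 1) := by
  set s₀ := (s.putTeam 1 ∅).putIdx 4 0 with hs₀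
  have hcore₀ : SameCore s s₀ := (sameCore_putTeam le_rfl).trans (sameCore_putIdx (by norm_num))
  obtain ⟨s', hrun, hcore, hteam, hsub, hcard, hle, hall⟩ := exists_runs_forAgents (f := I.f)
    (D := D) (G := I.level 40) (s := s₀) (r := 3) (P := truncateStep) (T := 4)
    -- Index register `4` counts the chosen agents. While there is room, all demanded agents seen so
    -- far have been taken, so at the end either nothing was cut or the size is exactly `k + 1`.
    (fun m s' => SameCore s s' ∧ s'.team 2 = s.team 2 ∧
      (∀ l ∈ s'.team 1, l ∈ s.team 2 ∧ (l : ℕ) < m) ∧ (s'.team 1).card = s'.idx 4 ∧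
      s'.idx 4 ≤ k + 1 ∧ (s'.idx 4 < k + 1 → ∀ l ∈ s.team 2, (l : ℕ) < m → l ∈ s'.team 1))
    (by
      refine ⟨hcore₀.trans (sameCore_putIdx le_rfl), ?_, ?_, ?_, ?_, ?_⟩ <;>
        simp [hs₀, Store.putIdx, Store.putTeam])
    (by
      rintro m hm s₁ hs₁ ⟨hcore, hteam, hsub, hcard, hle, hall⟩
      have e1 : s₁.idx 1 = k := (hcore.idx 1 (by norm_num)).trans h1
      by_cases hmem : (⟨m, hm⟩ : Fin n) ∈ s.team 2
      · have hholds : Test.holds s₁ (.isMember (.reg 3) 2) :=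
          ⟨⟨m, hm⟩, by rwa [hteam], by simp [IdxExpr.eval, hs₁]⟩
        by_cases hroom : s₁.idx 4 < k + 1
        · have hnew : (⟨m, hm⟩ : Fin n) ∉ s₁.team 1 := fun hcon => lt_irrefl m (hsub _ hcon).2
          have hag : agentSet n m = {⟨m, hm⟩} := agentSet_val ⟨m, hm⟩
          refine ⟨_, (Runs.cond_true hholds (by trivial) (Runs.cond_true ?_ (by trivial)
            ((Runs.include_ 1 (.reg 3)).seq (Runs.setIdx 4 (.succ (.reg 4)))))).mono ?_,
            ?_, ?_, ?_, ?_, ?_, ?_, ?_⟩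
          · simpa [Test.holds, IdxExpr.eval, e1] using hroom
          · simp [Test.nodes]
          · simpa [Store.putTeam, Store.putIdx] using hs₁
          · exact ((hcore.trans (sameCore_putTeam le_rfl)).trans
              (sameCore_putIdx (by norm_num))).trans (sameCore_putIdx le_rfl)
          · simpa [Store.putTeam, Store.putIdx] using hteam
          · intro l hl
            simp only [Store.putTeam, Store.putIdx, IdxExpr.eval, hs₁, hag, Function.update_self,
              Finset.mem_union, Finset.mem_singleton] at hl
            rcases hl with hl | rfl
            · exact ⟨(hsub l hl).1, (hsub l hl).2.trans (Nat.lt_succ_self m)⟩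
            · exact ⟨hmem, Nat.lt_succ_self m⟩
          · simp [Store.putTeam, Store.putIdx, IdxExpr.eval, hs₁, hag, hcard,
              Finset.card_insert_of_notMem hnew]
          · simpa [Store.putTeam, Store.putIdx, IdxExpr.eval] using hroom
          · intro _ l hl hlm
            simp only [Store.putTeam, Store.putIdx, IdxExpr.eval, hs₁, hag, Function.update_self,
              Finset.mem_union, Finset.mem_singleton]
            rcases Nat.lt_succ_iff_lt_or_eq.1 hlm with h | h
            · exact Or.inl (hall hroom l hl h)
            · exact Or.inr (Fin.ext h)
        · refine ⟨s₁, (Runs.cond_true hholds (by trivial) (Runs.cond_false ?_ (by trivial) Runs.skip)).mono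
            ?_, hs₁, hcore.trans (sameCore_putIdx le_rfl), hteam, ?_, ?_, ?_, ?_⟩
          · simpa [Test.holds, IdxExpr.eval, e1] using hroom
          · simp [Test.nodes]
          · exact fun l hl => ⟨(hsub l hl).1, (hsub l hl).2.trans (Nat.lt_succ_self m)⟩
          · simpa [Store.putIdx] using hcard
          · simpa [Store.putIdx] using hle
          · intro hcon
            exact absurd (by simpa [Store.putIdx] using hcon) hroom
      · refine ⟨s₁, (Runs.cond_false ?_ (by trivial) Runs.skip).mono ?_, hs₁,
          hcore.trans (sameCore_putIdx le_rfl), hteam, ?_, ?_, ?_, ?_⟩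
        · rintro ⟨l, hl, hlm⟩
          rw [hteam] at hl
          have : l = ⟨m, hm⟩ := Fin.ext (by simpa [IdxExpr.eval, hs₁] using hlm)
          exact hmem (this ▸ hl)
        · simp [Test.nodes]
        · exact fun l hl => ⟨(hsub l hl).1, (hsub l hl).2.trans (Nat.lt_succ_self m)⟩
        · simpa [Store.putIdx] using hcard
        · simpa [Store.putIdx] using hle
        · intro hlt l hl hlm
          rcases Nat.lt_succ_iff_lt_or_eq.1 hlm with h | h
          · exact hall (by simpa [Store.putIdx] using hlt) l hl h
          · exact absurd hl (by rwa [show l = ⟨m, hm⟩ from Fin.ext h]))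
  refine ⟨s', ?_, hcore, fun l hl => (hsub l hl).1, hcard.le.trans hle, ?_⟩
  · exact ((Runs.clear 1).seq ((Runs.setIdx 4 (.lit 0)).seq hrun)).mono (by omega)
  · rcases hle.lt_or_eq with h | h
    · exact Or.inl (Finset.Subset.antisymm (fun l hl => (hsub l hl).1)
        fun l hl => hall h l hl l.2)
    · exact Or.inr (hcard.trans h)

theorem exists_runs_evalCandidate {k : ℕ} (hk : k < n) (h1 : s.idx 1 = k) :
    ∃ s', Runs I.f D (I.level 40) evalCandidate s s' (n + 12) ∧ SameCore s s' ∧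
      s'.team = s.team ∧ s'.num 6 0 = I.f (s.team 1) / 2 ∧
      s'.num 7 0 = 1 / (2 * (k + 1 : ℕ)) ∧
      s'.num 6 0 ∈ I.level 40 ∧ s'.num 7 0 ∈ I.level 40 := by
  have lk : ((k + 1 : ℕ) : ℝ) ∈ I.level 1 := succ_mem_level hk
  have lf : I.f (s.team 1) ∈ I.level 1 := f_mem_level _
  have l1 : ((1 : ℚ) : ℝ) ∈ I.level 5 := by exact_mod_cast lit_mem_level 1 (by norm_num)
  have l2 : ((2 : ℚ) : ℝ) ∈ I.level 5 := by exact_mod_cast lit_mem_level 2 (by norm_num)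
  have m1 := div_mem_level lf l2
  have m2 := mul_mem_level l2 lk
  have m3 := div_mem_level l1 m2
  refine ⟨_, ((Runs.value 6 (.lit 0) 1 (level_mono (by norm_num) lf)).seq
    ((Runs.setNum 6 (.lit 0) (.div (.entry 6 (.lit 0)) (.lit 2)) ?_).seq
      (Runs.setNum 7 (.lit 0) (.div (.lit 1) (.mul (.lit 2) sizeExpr)) ?_))).mono ?_,
    ?_, rfl, ?_, ?_, ?_, ?_⟩
  · simp only [NumExpr.Within, NumExpr.eval, IdxExpr.eval, Store.putNum, Function.update_self]
    exact ⟨level_mono (by norm_num) lf, level_mono (by norm_num) l2, level_mono (by norm_num) m1⟩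
  · simp only [NumExpr.Within, NumExpr.eval, IdxExpr.eval, Store.putNum, sizeExpr, h1]
    exact ⟨level_mono (by norm_num) l1, ⟨level_mono (by norm_num) l2, level_mono (by norm_num) lk,
      level_mono (by norm_num) m2⟩, level_mono (by norm_num) m3⟩
  · simp only [NumExpr.nodes, sizeExpr]; omega
  · exact ((sameCore_putNum (by norm_num)).trans (sameCore_putNum (by norm_num))).trans
      (sameCore_putNum (by norm_num))
  · simp [NumExpr.eval, IdxExpr.eval, Store.putNum]
  · simp [NumExpr.eval, IdxExpr.eval, Store.putNum, sizeExpr, h1]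
  · simpa [NumExpr.eval, IdxExpr.eval, Store.putNum] using level_mono (by norm_num) m1
  · simpa [NumExpr.eval, IdxExpr.eval, Store.putNum, sizeExpr, h1] using
      level_mono (by norm_num) m3

theorem exists_runs_tryQuery (hD : IsDemandOracle I.f D) (h : I.Sound s) {k j : ℕ} (hk : k < n)
    (hj : j < n) (h1 : s.idx 1 = k) (h2 : s.idx 2 = j) (hv : s.num 4 0 ∈ I.level 1)
    (hv0 : 0 ≤ s.num 4 0) :
    ∃ s', Runs I.f D (I.level 40) tryQuery s s' (27 * n + 30) ∧ I.Sound s' ∧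
      (∀ r < 3, s'.idx r = s.idx r) ∧ s'.num 4 = s.num 4 ∧ s.num 3 0 ≤ s'.num 3 0 ∧
      I.Tried D (s.num 4 0) (k + 1) (j + 1) (s'.num 3 0) := by
  obtain ⟨s₁, hrun₁, hcore₁, hprice⟩ := exists_runs_setPrices (D := D) h hk hj h1 h2 hv
  have hp : (fun i : Fin n => s₁.num 5 i) = I.price (s.num 4 0) (k + 1) (j + 1) :=
    funext fun l => (hprice l).1
  have hrun₂ := Runs.demand (f := I.f) (D := D) (G := I.level 40) (s := s₁) 2 5
    fun l => (hprice l).2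
  rw [hp] at hrun₂
  set Q := D (I.price (s.num 4 0) (k + 1) (j + 1)) with hQ
  have hcore₂ : SameCore s (s₁.putTeam 2 Q) := hcore₁.trans (sameCore_putTeam (by norm_num))
  obtain ⟨s₃, hrun₃, hcore₃, hsub, hcard, hcase⟩ := exists_runs_truncate (I := I) (D := D)
    ((hcore₂.idx 1 (by norm_num)).trans h1)
  have hteam2 : (s₁.putTeam 2 Q).team 2 = Q := by simp [Store.putTeam]
  rw [hteam2] at hsub hcase
  have hcore₃' := hcore₂.trans hcore₃
  obtain ⟨s₄, hrun₄, hcore₄, hteam₄, e6, e7, h6, h7⟩ := exists_runs_evalCandidate (I := I)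
    (D := D) hk ((hcore₃'.idx 1 (by norm_num)).trans h1)
  have hcore := hcore₃'.trans hcore₄
  have hk0 : (0 : ℝ) < (k + 1 : ℕ) := by positivity
  have hk1 : (1 : ℝ) ≤ (k + 1 : ℕ) := by exact_mod_cast Nat.le_add_left 1 k
  have hcardR : ((s₃.team 1).card : ℝ) ≤ (k + 1 : ℕ) := by exact_mod_cast hcard
  obtain ⟨s₅, hrun₅, hsound, hidx, hnum4, hmono, hle⟩ := exists_runs_updateBest (D := D)
    (h.of_sameCore hcore) (by
      intro _ _
      rw [hteam₄, e6, e7]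
      refine ⟨⟨by positivity, ?_, ?_⟩, ?_⟩
      · rw [div_le_one (by positivity)]; linarith
      · intro i hi
        have h3 := Problem.price_le_marginal hD (Problem.price_nonneg hv0 (k + 1) (j + 1)) hsub hi
        have h4 : 0 ≤ ((j + 1 : ℕ) : ℝ) * s.num 4 0 / (4 * (k + 1 : ℕ)) := by positivity
        have h5 : 2 * ((k + 1 : ℕ) : ℝ) * I.c i ≤ I.f (s₃.team 1) - I.f ((s₃.team 1).erase i) := by
          rw [Problem.price] at h3
          linarith
        rw [div_mul_eq_mul_div, one_mul, le_div_iff₀ (by positivity)]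
        linarith
      -- At most `k + 1` members at share `1 / (2 * (k + 1))` receive at most half, so half the
      -- value is guaranteed.
      · have h3 : ((s₃.team 1).card : ℝ) * (1 / (2 * (k + 1 : ℕ))) ≤ 1 / 2 := by
          rw [mul_one_div, div_le_iff₀ (by positivity)]
          linarith
        have h4 := I.f_nonneg (s₃.team 1)
        nlinarith) h6 h7
  refine ⟨s₅, (hrun₁.seq (hrun₂.seq (hrun₃.seq (hrun₄.seq hrun₅)))).mono (by omega), hsound,
    fun r hr => ?_, ?_, ?_, s₃.team 1, hsub, hcase, ?_⟩
  · rw [hidx, hcore.idx r hr]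
  · rw [hnum4, hcore.num 4 (by norm_num)]
  · rwa [hcore.num 3 (by norm_num)] at hmono
  · rw [e6] at hle; linarith

theorem exists_runs_trySingle (h : I.Sound s) {i : Fin n} (h0 : s.idx 0 = i) :
    ∃ s', Runs I.f D (I.level 40) trySingle s s' (3 * n + 22) ∧ I.Sound s' ∧
      s'.idx = s.idx ∧ s'.num 4 0 = I.f {i} ∧ s.num 3 0 ≤ s'.num 3 0 ∧
      I.f {i} - I.c i ≤ s'.num 3 0 := by
  have hteam : ((s.putTeam 1 ∅).putTeam 1 ((s.putTeam 1 ∅).team 1 ∪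
      agentSet n (IdxExpr.eval (s.putTeam 1 ∅) (.reg 0)))).team 1 = {i} := by
    simp [Store.putTeam, IdxExpr.eval, h0, agentSet_val]
  have hrun₁ := (Runs.clear (f := I.f) (D := D) (G := I.level 40) (s := s) 1)
  have hrun₂ := (Runs.include_ (f := I.f) (D := D) (G := I.level 40) (s := s.putTeam 1 ∅) 1
    (.reg 0))
  set s₂ := (s.putTeam 1 ∅).putTeam 1 ((s.putTeam 1 ∅).team 1 ∪
      agentSet n (IdxExpr.eval (s.putTeam 1 ∅) (.reg 0))) with hs₂
  have hcore₂ : SameCore s s₂ := (sameCore_putTeam le_rfl).trans (sameCore_putTeam le_rfl)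
  have lf : I.f {i} ∈ I.level 1 := f_mem_level _
  have lc : I.c i ∈ I.level 1 := c_mem_level _
  have m1 := sub_mem_level lf lc
  have m2 := div_mem_level lc lf
  have hrun₃ := Runs.value (f := I.f) (D := D) (G := I.level 40) (s := s₂) 4 (.lit 0) 1
    (by rw [hteam]; exact level_mono (by norm_num) lf)
  rw [hteam] at hrun₃
  set s₃ := s₂.putNum 4 (IdxExpr.eval s₂ (.lit 0)) (I.f {i}) with hs₃
  -- Array `4` belongs to the core, so `SameCore` fails here, but soundness reads only arrays below
  -- `4`.
  have hsound₃ : I.Sound s₃ := (h.of_sameCore hcore₂).congr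
    (fun a ha => Function.update_of_ne (by omega) _ _) rfl
  have hc : s₃.num 0 i = I.c i := hsound₃.costs i
  have hi : s₃.idx 0 = i := h0
  have h4 : s₃.num 4 0 = I.f {i} := by simp [hs₃, Store.putNum, IdxExpr.eval]
  have hrun₄ := Runs.setNum (f := I.f) (D := D) (G := I.level 40) (s := s₃) 6 (.lit 0)
    (.sub (.entry 4 (.lit 0)) (.entry 0 (.reg 0))) (by
      simp only [NumExpr.Within, NumExpr.eval, IdxExpr.eval, hi, hc, h4]
      exact ⟨level_mono (by norm_num) lf, level_mono (by norm_num) lc, level_mono (by norm_num) m1⟩)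
  simp only [NumExpr.eval, IdxExpr.eval, hi, hc, h4] at hrun₄
  set s₄ := s₃.putNum 6 0 (I.f {i} - I.c i) with hs₄
  have hcore₄ : SameCore s₃ s₄ := sameCore_putNum (by norm_num)
  have hi' : s₄.idx 0 = i := h0
  have hc' : s₄.num 0 i = I.c i := by rw [hcore₄.num 0 (by norm_num), hc]
  have h4' : s₄.num 4 0 = I.f {i} := by rw [hcore₄.num 4 (by norm_num), h4]
  have hrun₅ := Runs.setNum (f := I.f) (D := D) (G := I.level 40) (s := s₄) 7 (.lit 0)
    (.div (.entry 0 (.reg 0)) (.entry 4 (.lit 0))) (by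
      simp only [NumExpr.Within, NumExpr.eval, IdxExpr.eval, hi', hc', h4']
      exact ⟨level_mono (by norm_num) lc, level_mono (by norm_num) lf, level_mono (by norm_num) m2⟩)
  simp only [NumExpr.eval, IdxExpr.eval, hi', hc', h4'] at hrun₅
  set s₅ := s₄.putNum 7 0 (I.c i / I.f {i}) with hs₅
  have hcore₅ : SameCore s₃ s₅ := hcore₄.trans (sameCore_putNum (by norm_num))
  have e6 : s₅.num 6 0 = I.f {i} - I.c i := by simp [hs₅, hs₄, Store.putNum]
  have e7 : s₅.num 7 0 = I.c i / I.f {i} := by simp [hs₅, Store.putNum]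
  have eteam : s₅.team 1 = {i} := hteam
  have e3 : s₅.num 3 0 = s.num 3 0 := by
    simp [hs₅, hs₄, hs₃, Store.putNum, hcore₂.num 3 (by norm_num)]
  obtain ⟨s₆, hrun₆, hsound, hidx, hnum4, hmono, hle⟩ := exists_runs_updateBest (D := D)
    (hsound₃.of_sameCore hcore₅) (by
      intro hnn _
      rw [e6] at hnn
      have hcpos := I.c_pos i
      -- A winning candidate has `f {i} ≥ c i > 0`, so the share `c i / f {i}` is a genuine
      -- quotient, at most `1`.
      have hfpos : 0 < I.f {i} := by linarith
      rw [eteam, e6, e7]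
      refine ⟨⟨by positivity, ?_, ?_⟩, ?_⟩
      · rw [div_le_one hfpos]; linarith
      · intro l hl
        rw [Finset.mem_singleton.1 hl]
        have he : I.f (({i} : Finset (Fin n)).erase i) = 0 := by simp [I.f_empty]
        rw [he, sub_zero, div_mul_cancel₀ _ hfpos.ne']
      · rw [Finset.card_singleton, Nat.cast_one, one_mul, sub_mul, one_mul,
          div_mul_cancel₀ _ hfpos.ne'])
    (by rw [e6]; exact level_mono (by norm_num) m1) (by rw [e7]; exact level_mono (by norm_num) m2)
  refine ⟨s₆, (hrun₁.seq (hrun₂.seq (hrun₃.seq (hrun₄.seq (hrun₅.seq hrun₆))))).mono ?_, hsound,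
    ?_, ?_, ?_, ?_⟩
  · simp only [NumExpr.nodes]; omega
  · rw [hidx]; rfl
  · rw [hnum4, hcore₅.num 4 (by norm_num), h4]
  · rwa [e3] at hmono
  · rwa [e6] at hle

theorem exists_runs_writeShares (h : I.Sound s) :
    ∃ s', Runs I.f D (I.level 40) writeShares s s' (n * 5 + 2) ∧ s'.team 0 = s.team 0 ∧
      ∀ l : Fin n, s'.num 1 l = if l ∈ s.team 0 then s.num 2 0 else 0 := by
  obtain ⟨s', hrun, hteam, -, hlt, hge⟩ := exists_runs_forAgents (f := I.f) (D := D)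
    (G := I.level 40) (s := s) (r := 3) (T := 3)
    (P := .cond (.isMember (.reg 3) 0) (.setNum 1 (.reg 3) (.entry 2 (.lit 0))) .skip)
    -- The entries not yet reached must be known to be zero, because nothing is written for agents
    -- outside the team.
    (fun m s' => s'.team 0 = s.team 0 ∧ s'.num 2 = s.num 2 ∧
      (∀ l : Fin n, (l : ℕ) < m → s'.num 1 l = if l ∈ s.team 0 then s.num 2 0 else 0) ∧
      ∀ l : Fin n, m ≤ (l : ℕ) → s'.num 1 l = 0)
    ⟨rfl, rfl, fun l hl => absurd hl (by omega), fun l _ => h.out l⟩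
    (by
      rintro m hm s₁ hs₁ ⟨hteam, h2, hlt, hge⟩
      by_cases hmem : (⟨m, hm⟩ : Fin n) ∈ s.team 0
      · have hholds : Test.holds s₁ (.isMember (.reg 3) 0) :=
          ⟨⟨m, hm⟩, by rwa [hteam], by simp [IdxExpr.eval, hs₁]⟩
        refine ⟨_, (Runs.cond_true hholds (by trivial)
          (Runs.setNum 1 (.reg 3) (.entry 2 (.lit 0)) ?_)).mono ?_, hs₁, hteam, ?_, ?_, ?_⟩
        · simpa [NumExpr.Within, IdxExpr.eval, h2] using h.share_mem
        · simp [Test.nodes, NumExpr.nodes]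
        · simpa [Store.putNum, Store.putIdx] using h2
        · intro l hl
          by_cases hlm : (l : ℕ) = m
          · have : l = ⟨m, hm⟩ := Fin.ext hlm
            subst this
            simp [Store.putNum, Store.putIdx, IdxExpr.eval, NumExpr.eval, hs₁, hmem, h2]
          · simpa [Store.putNum, Store.putIdx, IdxExpr.eval, NumExpr.eval, hs₁, hlm] using
              hlt l (by omega)
        · intro l hl
          have hlm : (l : ℕ) ≠ m := by omega
          simpa [Store.putNum, Store.putIdx, IdxExpr.eval, NumExpr.eval, hs₁, hlm] using
            hge l (by omega)
      · refine ⟨s₁, (Runs.cond_false ?_ (by trivial) Runs.skip).mono ?_, hs₁, hteam, h2, ?_,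
          fun l hl => hge l (by omega)⟩
        · rintro ⟨l, hl, hlm⟩
          rw [hteam] at hl
          have : l = ⟨m, hm⟩ := Fin.ext (by simpa [IdxExpr.eval, hs₁] using hlm)
          exact hmem (this ▸ hl)
        · simp [Test.nodes]
        · intro l hl
          rcases Nat.lt_succ_iff_lt_or_eq.1 hl with h' | h'
          · exact hlt l h'
          · have : l = ⟨m, hm⟩ := Fin.ext h'
            subst this
            rw [if_neg hmem]
            exact hge _ le_rfl)
  exact ⟨s', hrun, hteam, fun l => hlt l l.2⟩

/-! ### The nested loops over value guesses, team sizes and agents -/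

theorem exists_runs_guesses (hD : IsDemandOracle I.f D) (h : I.Sound s) {k : ℕ} (hk : k < n)
    (h1 : s.idx 1 = k) (hv : s.num 4 0 ∈ I.level 1) (hv0 : 0 ≤ s.num 4 0) :
    ∃ s', Runs I.f D (I.level 40) (forAgents 2 tryQuery) s s' (n * (27 * n + 32) + 2) ∧
      I.Sound s' ∧ (∀ r < 2, s'.idx r = s.idx r) ∧ s'.num 4 = s.num 4 ∧
      s.num 3 0 ≤ s'.num 3 0 ∧
      ∀ j < n, I.Tried D (s.num 4 0) (k + 1) (j + 1) (s'.num 3 0) := by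
  exact exists_runs_forAgents (f := I.f) (D := D) (G := I.level 40) (s := s) (r := 2)
    (P := tryQuery) (T := 27 * n + 30)
    (fun m s' => I.Sound s' ∧ (∀ r < 2, s'.idx r = s.idx r) ∧ s'.num 4 = s.num 4 ∧
      s.num 3 0 ≤ s'.num 3 0 ∧ ∀ j < m, I.Tried D (s.num 4 0) (k + 1) (j + 1) (s'.num 3 0))
    ⟨h.congr (fun _ _ => rfl) rfl, fun r hr => Function.update_of_ne (by omega) _ _, rfl, le_rfl,
      fun j hj => absurd hj (by omega)⟩
    (by
      rintro m hm s₁ hs₁ ⟨hsound, hidx, h4, hle, htried⟩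
      obtain ⟨s₂, hrun, hsound₂, hidx₂, h4₂, hle₂, htried₂⟩ := exists_runs_tryQuery hD hsound hk hm
        ((hidx 1 (by norm_num)).trans h1) hs₁ (by rwa [h4]) (by rwa [h4])
      rw [h4] at htried₂
      refine ⟨s₂, hrun, (hidx₂ 2 (by norm_num)).trans hs₁, hsound₂.congr (fun _ _ => rfl) rfl, ?_,
        h4₂.trans h4, hle.trans hle₂, fun j hj => ?_⟩
      · intro r hr
        refine (Function.update_of_ne (by omega) _ _).trans ?_
        rw [hidx₂ r (by omega), hidx r hr]
      · rcases Nat.lt_succ_iff_lt_or_eq.1 hj with h' | rfl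
        · exact (htried j h').mono hle₂
        · exact htried₂)

theorem exists_runs_sizes (hD : IsDemandOracle I.f D) (h : I.Sound s)
    (hv : s.num 4 0 ∈ I.level 1) (hv0 : 0 ≤ s.num 4 0) :
    ∃ s', Runs I.f D (I.level 40) (forAgents 1 (forAgents 2 tryQuery)) s s'
        (n * (n * (27 * n + 32) + 4) + 2) ∧
      I.Sound s' ∧ s'.idx 0 = s.idx 0 ∧ s'.num 4 = s.num 4 ∧ s.num 3 0 ≤ s'.num 3 0 ∧
      ∀ k < n, ∀ j < n, I.Tried D (s.num 4 0) (k + 1) (j + 1) (s'.num 3 0) := by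
  exact exists_runs_forAgents (f := I.f) (D := D) (G := I.level 40) (s := s) (r := 1)
    (P := forAgents 2 tryQuery) (T := n * (27 * n + 32) + 2)
    (fun m s' => I.Sound s' ∧ s'.idx 0 = s.idx 0 ∧ s'.num 4 = s.num 4 ∧
      s.num 3 0 ≤ s'.num 3 0 ∧
      ∀ k < m, ∀ j < n, I.Tried D (s.num 4 0) (k + 1) (j + 1) (s'.num 3 0))
    ⟨h.congr (fun _ _ => rfl) rfl, by simp [Store.putIdx], rfl, le_rfl,
      fun j hj => absurd hj (by omega)⟩
    (by
      rintro m hm s₁ hs₁ ⟨hsound, hidx, h4, hle, htried⟩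
      obtain ⟨s₂, hrun, hsound₂, hidx₂, h4₂, hle₂, htried₂⟩ := exists_runs_guesses hD hsound hm hs₁
        (by rwa [h4]) (by rwa [h4])
      rw [h4] at htried₂
      refine ⟨s₂, hrun, (hidx₂ 1 (by norm_num)).trans hs₁, hsound₂.congr (fun _ _ => rfl) rfl, ?_,
        h4₂.trans h4, hle.trans hle₂, fun k hk => ?_⟩
      · simp [Store.putIdx, hidx₂, hidx]
      · rcases Nat.lt_succ_iff_lt_or_eq.1 hk with h' | rfl
        · exact fun j hj => (htried k h' j hj).mono hle₂
        · exact htried₂)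

theorem exists_runs_agents (hD : IsDemandOracle I.f D) (h : I.Sound s) :
    ∃ s', Runs I.f D (I.level 40)
        (forAgents 0 (.seq trySingle (forAgents 1 (forAgents 2 tryQuery)))) s s'
        (n * (3 * n + 22 + (n * (n * (27 * n + 32) + 4) + 2) + 2) + 2) ∧ I.Sound s' ∧
      ∀ i : Fin n, I.f {i} - I.c i ≤ s'.num 3 0 ∧
        ∀ k < n, ∀ j < n, I.Tried D (I.f {i}) (k + 1) (j + 1) (s'.num 3 0) := by
  obtain ⟨s', hrun, hsound, hall⟩ := exists_runs_forAgents (f := I.f) (D := D) (G := I.level 40)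
    (s := s) (r := 0) (P := .seq trySingle (forAgents 1 (forAgents 2 tryQuery)))
    (T := 3 * n + 22 + (n * (n * (27 * n + 32) + 4) + 2))
    (fun m s' => I.Sound s' ∧ ∀ i : Fin n, (i : ℕ) < m → I.f {i} - I.c i ≤ s'.num 3 0 ∧
      ∀ k < n, ∀ j < n, I.Tried D (I.f {i}) (k + 1) (j + 1) (s'.num 3 0))
    ⟨h.congr (fun _ _ => rfl) rfl, fun j hj => absurd hj (by omega)⟩
    (by
      rintro m hm s₁ hs₁ ⟨hsound, hall⟩
      obtain ⟨s₂, hrun₂, hsound₂, hidx₂, h4₂, hle₂, hsingle⟩ := exists_runs_trySingle (D := D)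
        (i := ⟨m, hm⟩) hsound hs₁
      obtain ⟨s₃, hrun₃, hsound₃, hidx₃, -, hle₃, htried⟩ := exists_runs_sizes hD hsound₂
        (by rw [h4₂]; exact f_mem_level _) (by rw [h4₂]; exact I.f_nonneg _)
      rw [h4₂] at htried
      refine ⟨s₃, hrun₂.seq hrun₃, by rw [hidx₃, hidx₂, hs₁],
        hsound₃.congr (fun _ _ => rfl) rfl, fun i hi => ?_⟩
      rcases Nat.lt_succ_iff_lt_or_eq.1 hi with h' | h'
      · obtain ⟨h5, h6⟩ := hall i h'
        exact ⟨h5.trans (hle₂.trans hle₃), fun k hk j hj => (h6 k hk j hj).mono (hle₂.trans hle₃)⟩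
      · have : i = ⟨m, hm⟩ := Fin.ext h'
        subst this
        exact ⟨hsingle.trans hle₃, htried⟩)
  exact ⟨s', hrun, hsound, fun i => hall i i.2⟩

theorem sound_init : I.Sound (Store.init I.c) where
  costs l := by simp [Store.init]
  out l := by simp [Store.init]
  feasible := ⟨by simp [Store.init], by simp [Store.init], by simp [Store.init]⟩
  nonneg := by simp [Store.init]
  le_rev := by simp [Store.init, I.f_empty]
  share_mem := by
    simpa [Store.init] using level_mono (by norm_num) (lit_mem_level (I := I) 0 (by norm_num))
  value_mem := by
    simpa [Store.init] using level_mono (by norm_num) (lit_mem_level (I := I) 0 (by norm_num))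

theorem exists_runs_algorithm (hD : IsDemandOracle I.f D) :
    ∃ s, Runs I.f D (I.level 40) algorithm (Store.init I.c) s (100 * (n + 1) ^ 4) ∧
      I.IsNonDiscriminatory s.outTeam s.outShare ∧
      ∀ T β, I.IsFair T β → I.rev T β ≤ 241 * I.rev s.outTeam s.outShare := by
  obtain ⟨s₁, hrun₁, h, hall⟩ := exists_runs_agents hD (sound_init (I := I))
  obtain ⟨s₂, hrun₂, hteam, hshare⟩ := exists_runs_writeShares (D := D) h
  have hout : ∀ l ∈ s₁.team 0, s₂.outShare l = s₁.num 2 0 := fun l hl => by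
    simp [Store.outShare, hshare, hl]
  have hrev : s₁.num 3 0 ≤ I.rev s₂.outTeam s₂.outShare := by
    rw [Problem.rev, Store.outTeam, hteam, Finset.sum_congr rfl hout, Finset.sum_const,
      nsmul_eq_mul]
    exact h.le_rev
  refine ⟨s₂, (hrun₁.seq hrun₂).mono (by nlinarith [Nat.zero_le (n ^ 3), Nat.zero_le (n ^ 2)]),
    ⟨⟨?_, ?_, ?_⟩, ?_⟩, fun T β hfair => ?_⟩
  · intro i hi
    rw [Store.outTeam, hteam] at hi
    rw [hout i hi]
    exact ⟨h.feasible.nonneg, h.feasible.le_one⟩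
  · intro i hi
    rw [Store.outTeam, hteam] at hi
    simp [Store.outShare, hshare, hi]
  · intro i hi
    rw [Store.outTeam, hteam] at hi ⊢
    rw [hout i hi]
    have := h.feasible.cost_le i hi
    linarith
  · intro i hi j hj
    rw [Store.outTeam, hteam] at hi hj
    rw [hout i hi, hout j hj]
  · refine (hfair.rev_le h.nonneg (fun i => (hall i).1) ?_).trans (by linarith)
    intro k B hk hkn hBk hB
    by_cases hf : 0 < I.f B
    · obtain ⟨i, j, hj1, hjk, hgood⟩ := Problem.exists_good_query hD hk hBk hB hf
      -- Loop counters start at `0`, so they are one less than `k` and `j`; the range covers `j`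
      -- because `j ≤ k ≤ n`.
      obtain ⟨S, hS, hcase, hle⟩ := (hall i).2 (k - 1) (by omega) (j - 1) (by omega)
      rw [Nat.sub_add_cancel hk, Nat.sub_add_cancel hj1] at hS hcase
      linarith [hgood S hS hcase]
    · linarith [h.nonneg]

end Sound

end TeamContract

end

open TeamContract in
theorem theorem5p2 :
    ∃ (P : Prog) (κ : ℝ) (p q : Polynomial ℕ), 0 < κ ∧
      ∀ (n : ℕ) (I : Problem n) (D : (Fin n → ℝ) → Finset (Fin n)), IsDemandOracle I.f D →
        ∃ (s : Store n) (t : ℕ),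
          Exec I.f D unitSize P (Store.init I.c) s t ∧ t ≤ p.eval n ∧
          (∀ b : ℕ, I.HasBits b →
            ∃ t' : ℕ, Exec I.f D bitSize P (Store.init I.c) s t' ∧ t' ≤ q.eval (n + b)) ∧
          I.IsNonDiscriminatory s.outTeam s.outShare ∧
          I.IsFair s.outTeam s.outShare ∧
          (∀ (T : Finset (Fin n)) (β : Fin n → ℝ), I.IsNonDiscriminatory T β →
            κ * I.rev T β ≤ I.rev s.outTeam s.outShare) ∧
          (∀ (T : Finset (Fin n)) (β : Fin n → ℝ), I.IsFair T β →
            κ * I.rev T β ≤ I.rev s.outTeam s.outShare) := by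
  refine ⟨algorithm, 1 / 241, 100 * (Polynomial.X + 1) ^ 4,
    100 * (Polynomial.X + 1) ^ 4 * (1 + 40 * (Polynomial.X + 1)), by norm_num, fun n I D hD => ?_⟩
  obtain ⟨s, hrun, hnd, hbest⟩ := exists_runs_algorithm hD
  have happrox : ∀ T β, I.IsFair T β → 1 / 241 * I.rev T β ≤ I.rev s.outTeam s.outShare :=
    fun T β h => by linarith [hbest T β h]
  obtain ⟨t, ht, hle⟩ := hrun unitSize 1 le_rfl fun _ _ => le_rfl
  refine ⟨s, t, ht, by simpa using hle, fun b hb => ?_, hnd, hnd.isFair,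
    fun T β h => happrox T β h.isFair, happrox⟩
  -- The same run and final store as for unit cost, with each number now charged its level-40 bit
  -- bound.
  obtain ⟨t', ht', hle'⟩ := hrun bitSize (1 + 40 * (n + b + 1)) (by omega)
    fun x hx => bitSize_le_of_mem_level hb hx
  refine ⟨t', ht', hle'.trans ?_⟩
  simp only [Polynomial.eval_mul, Polynomial.eval_pow, Polynomial.eval_add, Polynomial.eval_X,
    Polynomial.eval_one, Polynomial.eval_ofNat]
  gcongr
  omega
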